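/- Conventions. An (a,b)-module is a free $\mathbb{C}[[b]]$-module $E$ of finite rank with a $\mathbb{C}$-linear map $a : E \to E$ such that $ab - ba = b^2$ (hence $aS = Sa + b^2 S'$ for $S \in \mathbb{C}[[b]]$). For $\delta \in \mathbb{Q}$, $E_\delta = \mathbb{C}[[b]]\,e_\delta$ with $a e_\delta = \delta b e_\delta$. The dual $E^*$ is $\mathrm{Hom}_{\mathbb{C}[[b]]}(E, E_0)$ with $(a f)(x) = a(f(x)) - f(a x)$, and $E \otimes_{a,b} F$ is $E \otimes_{\mathbb{C}[[b]]} F$ with $a(x \otimes y) = ax \otimes y + x \otimes ay$. For $\Lambda \subset\, ]0,1] \cap \mathbb{Q}$ finite, $\Xi_\Lambda^{(N)} = \bigoplus_{\lambda \in \Lambda} \bigoplus_{j=0}^N \mathbb{C}[[b]]\,e_{\lambda,j}$ with $a e_{\lambda,0} = \lambda b e_{\lambda,0}$ and $a e_{\lambda,j} = \lambda b e_{\lambda,j} + b e_{\lambda,j-1}$ for $j \ge 1$. A theme is an (a,b)-module isomorphic to the submodule of some $\Xi_\Lambda^{(N)}$ generated over $\mathbb{C}[[b]]$ by $a^\nu\varphi$,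 $\nu \ge 0$, for one element $\varphi$; it is $[\lambda]$-primitive, for $\lambda \in\, ]0,1] \cap \mathbb{Q}$, if one can take $\Lambda = \{\lambda\}$. Let $X$ be a reduced complex space. A sheaf of $\mathcal{O}_X$-(a,b)-modules is a locally free sheaf $\mathbb{E}$ of finite type of $\mathcal{O}_X[[b]]$-modules with an $\mathcal{O}_X$-linear, $b$-adically continuous map $a : \mathbb{E} \to \mathbb{E}$ such that $ab - ba = b^2$; its fibres are the (a,b)-modules $E(x) = \mathbb{E}/\mathcal{M}_x[[b]]\,\mathbb{E}$, where $\mathcal{M}_x[[b]]$ is the kernel of the evaluation $\mathcal{O}_X[[b]] \to \mathbb{C}[[b]]$ at $x$. A holomorphic map $\varphi : U \to \Xi_\Lambda^{(N)}$ on an open set $U$ (a section of $\bigoplus_{\lambda,j} \mathcal{O}_X[[b]]\,e_{\lambda,j}$ on $U$) is $k$-thematic if the $\mathcal{O}_U[[b]]$-module $\mathbb{E}_\varphi$ generated by the $a^\nu \varphi$, $\nu \ge 0$, is free with basis $\varphi, a\varphi, \dots, a^{k-1}\varphi$ and, for each $x \in U$, the elements $\varphi(x), a\varphi(x), \dots,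 a^{k-1}\varphi(x)$ are linearly independent over $\mathbb{C}[[b]]$ (so that the fibre of $\mathbb{E}_\varphi$ at $x$ is the submodule generated by the $a^\nu\varphi(x)$). The sheaf $\mathbb{E}$ is a holomorphic family of rank $k$ themes if $X$ is covered by open sets $U$ for each of which there are a finite set $\Lambda \subset\, ]0,1] \cap \mathbb{Q}$, a $k$-thematic map $\varphi : U \to \Xi_\Lambda^{(k-1)}$ and an isomorphism $\mathbb{E}|_U \simeq \mathbb{E}_\varphi$ of sheaves of $\mathcal{O}_U$-(a,b)-modules (with $\Xi_\Lambda^{(-1)} = 0$). Theorem. Let $X$ be a reduced complex space, let $\lambda \in\, ]0,1] \cap \mathbb{Q}$ and let $\mathbb{E}$ be a holomorphic family of rank $k$ themes on $X$ all of whose fibres $E(x)$, $x \in X$, are $[\lambda]$-primitive themes. Let $\delta \in \mathbb{Q}$ be such that for each $x \in X$ the (a,b)-module $E(x)^* \otimes_{a,b} E_\delta$ is a theme. Then the family $E(x)^* \otimes_{a,b} E_\delta$, $x \in X$, that is, the sheaf of $\mathcal{O}_X$-(a,b)-modules $\mathcal{H}om_{\mathcal{O}_X[[b]]}(\mathbb{E},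 \mathcal{O}_X[[b]]) \otimes_{a,b} E_\delta$, whose fibres are the $E(x)^* \otimes_{a,b} E_\delta$, is a holomorphic family of rank $k$ themes. -/

import Mathlib

open TopologicalSpace
open scoped PowerSeries TensorProduct

universe u v

noncomputable section

namespace Themes

/-! ### (a,b)-modules -/

/-- The operator `b² d/db` on `ℂ[[b]]`; the variable `b` is `PowerSeries.X`. -/
def bbD (S : ℂ⟦X⟧) : ℂ⟦X⟧ := PowerSeries.X ^ 2 * PowerSeries.derivative ℂ S

theorem bbD_add (S T : ℂ⟦X⟧) : bbD (S + T) = bbD S + bbD T := by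
  simp [bbD, mul_add]

theorem bbD_mul (S T : ℂ⟦X⟧) : bbD (S * T) = S * bbD T + bbD S * T := by
  simp only [bbD, Derivation.leibniz, smul_eq_mul]; ring

/-- The action of `a` on a `ℂ[[b]]`-module. The relation `a S = S a + b² S'` for all `S ∈ ℂ[[b]]`
says that `a` is `ℂ`-linear (`S` constant) and that `a b - b a = b²` (`S = b`); for general `S` it
is the same relation extended by `b`-adic continuity, and it holds automatically on a free module
of finite rank. An (a,b)-module is a free `ℂ[[b]]`-module of finite rank with such an action. -/
class ABModule (E : Type u) [AddCommGroup E] [Module ℂ⟦X⟧ E] where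
  /-- the operator `a` -/
  a : E →+ E
  a_smul : ∀ (S : ℂ⟦X⟧) (x : E), a (S • x) = S • a x + bbD S • x

/-- The operator `a`. -/
abbrev opA {E : Type u} [AddCommGroup E] [Module ℂ⟦X⟧ E] [ABModule E] : E →+ E := ABModule.a

/-- The rank one (a,b)-module `E_δ = ℂ[[b]] e_δ` with `a e_δ = δ b e_δ`;
the series `S` stands for `S e_δ`. -/
def RankOne (_δ : ℚ) : Type := ℂ⟦X⟧

instance (δ : ℚ) : AddCommGroup (RankOne δ) := inferInstanceAs (AddCommGroup ℂ⟦X⟧)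

instance (δ : ℚ) : Module ℂ⟦X⟧ (RankOne δ) := inferInstanceAs (Module ℂ⟦X⟧ ℂ⟦X⟧)

/-- The series `S`, for the element `S e_δ` of `E_δ`. -/
def RankOne.series {δ : ℚ} (x : RankOne δ) : ℂ⟦X⟧ := x

/-- The coefficient of `e_δ` in `a (S e_δ)`. -/
def rankOneA (δ : ℚ) (S : ℂ⟦X⟧) : ℂ⟦X⟧ := bbD S + PowerSeries.C (δ : ℂ) * PowerSeries.X * S

theorem rankOneA_add (δ : ℚ) (S T : ℂ⟦X⟧) :
    rankOneA δ (S + T) = rankOneA δ S + rankOneA δ T := by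
  simp only [rankOneA, bbD_add]; ring

theorem rankOneA_mul (δ : ℚ) (S T : ℂ⟦X⟧) :
    rankOneA δ (S * T) = S * rankOneA δ T + bbD S * T := by
  simp only [rankOneA, bbD_mul]; ring

instance (δ : ℚ) : ABModule (RankOne δ) where
  a := AddMonoidHom.mk' (M := RankOne δ) (rankOneA δ) (rankOneA_add δ)
  a_smul := rankOneA_mul δ

section Constructions

variable {E : Type u} [AddCommGroup E] [Module ℂ⟦X⟧ E] [ABModule E]
variable {F : Type v} [AddCommGroup F] [Module ℂ⟦X⟧ F] [ABModule F]

/-- `Hom_{a,b}(E, F)`: the `ℂ[[b]]`-linear maps, with `(a f)(x) = a (f x) - f (a x)`. -/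
instance instABModuleHom : ABModule (E →ₗ[ℂ⟦X⟧] F) where
  a := AddMonoidHom.mk' (fun f =>
      { toFun := fun x => opA (f x) - f (opA x)
        map_add' := fun x y => by simp only [map_add]; abel
        map_smul' := fun S x => by
          simp only [map_smul, ABModule.a_smul, map_add, RingHom.id_apply, smul_sub]; abel })
    (fun f g => by
      ext x
      simp only [LinearMap.add_apply, LinearMap.coe_mk, AddHom.coe_mk, map_add]; abel)
  a_smul S f := by
    ext x
    simp only [AddMonoidHom.mk'_apply, LinearMap.add_apply, LinearMap.smul_apply,
      LinearMap.coe_mk, AddHom.coe_mk, ABModule.a_smul, smul_sub]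
    abel

/-- `E ⊗_{a,b} F`: the tensor product over `ℂ[[b]]`,
with `a (x ⊗ y) = a x ⊗ y + x ⊗ a y`. -/
def tensorA : E ⊗[ℂ⟦X⟧] F →+ E ⊗[ℂ⟦X⟧] F :=
  TensorProduct.liftAddHom
    (AddMonoidHom.mk' (fun x : E =>
        AddMonoidHom.mk' (fun y : F => opA x ⊗ₜ[ℂ⟦X⟧] y + x ⊗ₜ[ℂ⟦X⟧] opA y)
          (fun y z => by simp only [map_add, TensorProduct.tmul_add]; abel))
      (fun x y => by
        ext z
        simp only [AddMonoidHom.mk'_apply, AddMonoidHom.add_apply, map_add,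
          TensorProduct.add_tmul]
        abel))
    (fun S x y => by
      simp only [AddMonoidHom.mk'_apply, ABModule.a_smul, TensorProduct.add_tmul,
        TensorProduct.tmul_add, TensorProduct.smul_tmul]
      abel)

theorem tensorA_tmul (x : E) (y : F) :
    tensorA (x ⊗ₜ[ℂ⟦X⟧] y) = opA x ⊗ₜ[ℂ⟦X⟧] y + x ⊗ₜ[ℂ⟦X⟧] opA y := rfl

instance instABModuleTensor : ABModule (E ⊗[ℂ⟦X⟧] F) where
  a := tensorA
  a_smul S t := by
    induction t with
    | zero => simp
    | tmul x y =>
      rw [TensorProduct.smul_tmul', tensorA_tmul, tensorA_tmul, ABModule.a_smul]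
      simp only [TensorProduct.add_tmul, smul_add, TensorProduct.smul_tmul']
      abel
    | add s t hs ht => simp only [smul_add, map_add, hs, ht]; abel

end Constructions

/-- The dual (a,b)-module `E* = Hom_{a,b}(E, E_0)`. -/
abbrev ABDual (E : Type u) [AddCommGroup E] [Module ℂ⟦X⟧ E] : Type u := E →ₗ[ℂ⟦X⟧] RankOne 0

/-! ### Asymptotic expansions and themes -/

/-- `Ξ_Λ^{(n-1)} = ⊕_{l ∈ Λ} ⊕_{j < n} ℂ[[b]] e_{l,j}`, where `e_{l,j}` stands for
`s^{l-1} (Log s)^j / j!`. An element is given by its coefficients. -/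
abbrev Xi (Λ : Finset ℚ) (n : ℕ) : Type := Λ → Fin n → ℂ⟦X⟧

/-- The coefficients of `a φ`, where `a e_{l,0} = l b e_{l,0}` and
`a e_{l,j} = l b e_{l,j} + b e_{l,j-1}` for `j ≥ 1`. -/
def xiA {Λ : Finset ℚ} {n : ℕ} (φ : Xi Λ n) : Xi Λ n := fun l j =>
  bbD (φ l j) + PowerSeries.C ((l : ℚ) : ℂ) * PowerSeries.X * φ l j +
    if h : (j : ℕ) + 1 < n then PowerSeries.X * φ l ⟨j + 1, h⟩ else 0

instance instABModuleXi (Λ : Finset ℚ) (n : ℕ) : ABModule (Xi Λ n) where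
  a := AddMonoidHom.mk' xiA (fun φ ψ => by
    funext l j
    simp only [xiA, Pi.add_apply, bbD_add]
    split_ifs <;> ring)
  a_smul S φ := by
    funext l j
    simp only [AddMonoidHom.mk'_apply, xiA, Pi.add_apply, Pi.smul_apply, smul_eq_mul, bbD_mul]
    split_ifs <;> ring

/-- `E` is isomorphic, as an (a,b)-module, to the submodule of `Ξ_Λ^{(n-1)}` generated by
`φ, a φ, a² φ, …`. -/
def IsGeneratedBy (E : Type u) [AddCommGroup E] [Module ℂ⟦X⟧ E] [ABModule E]
    {Λ : Finset ℚ} {n : ℕ} (φ : Xi Λ n) : Prop :=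
  ∃ ι : E →ₗ[ℂ⟦X⟧] Xi Λ n, Function.Injective ι ∧ (∀ x, ι (opA x) = opA (ι x)) ∧
    LinearMap.range ι = Submodule.span ℂ⟦X⟧ (Set.range fun ν : ℕ => opA^[ν] φ)

/-- Themes: the (a,b)-modules isomorphic to a monogenic submodule of some `Ξ_Λ^{(N)}` with
`Λ ⊂ ]0,1] ∩ ℚ` finite. -/
def IsTheme (E : Type u) [AddCommGroup E] [Module ℂ⟦X⟧ E] [ABModule E] : Prop :=
  ∃ (Λ : Finset ℚ) (n : ℕ) (φ : Xi Λ n), (∀ l ∈ Λ, 0 < l ∧ l ≤ 1) ∧ IsGeneratedBy E φ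

/-- `[l]`-primitive themes, for `l ∈ ]0,1] ∩ ℚ`: those that embed in some `Ξ_l^{(N)}`. -/
def IsPrimitiveTheme (l : ℚ) (E : Type u) [AddCommGroup E] [Module ℂ⟦X⟧ E] [ABModule E] : Prop :=
  ∃ (n : ℕ) (φ : Xi {l} n), IsGeneratedBy E φ

/-! ### Reduced complex spaces -/

/-- A reduced complex space: a Hausdorff space `X` with a sheaf `𝒪_X` of algebras of complex
valued functions, locally isomorphic to a set `{w ∈ W | g w = 0}` of common zeros of finitely many
holomorphic functions on an open set `W ⊂ ℂⁿ`, with the functions that are locally restrictions of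
holomorphic functions of `n` variables. -/
class ReducedComplexSpace (X : TopCat.{u}) where
  t2 : T2Space X
  /-- the structure sheaf -/
  hol : TopCat.LocalPredicate fun _ : X => ℂ
  const_mem : ∀ (U : Opens X) (c : ℂ), hol.pred fun _ : U => c
  add_mem : ∀ {U : Opens X} {f g : U → ℂ}, hol.pred f → hol.pred g → hol.pred fun x => f x + g x
  mul_mem : ∀ {U : Opens X} {f g : U → ℂ}, hol.pred f → hol.pred g → hol.pred fun x => f x * g x
  chart : ∀ x : X, ∃ (U : Opens X) (n m : ℕ) (W : Set (Fin n → ℂ))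
    (g : (Fin n → ℂ) → (Fin m → ℂ)) (z : U → (Fin n → ℂ)),
    x ∈ U ∧ IsOpen W ∧ DifferentiableOn ℂ g W ∧ Topology.IsEmbedding z ∧
    Set.range z = {w | w ∈ W ∧ g w = 0} ∧
    ∀ (V : Opens X) (hV : V ≤ U) (f : V → ℂ), hol.pred f ↔
      ∀ y : V, ∃ (N : Set (Fin n → ℂ)) (G : (Fin n → ℂ) → ℂ),
        IsOpen N ∧ z ⟨y, hV y.2⟩ ∈ N ∧ DifferentiableOn ℂ G N ∧
        ∀ y' : V, z ⟨y', hV y'.2⟩ ∈ N → f y' = G (z ⟨y', hV y'.2⟩)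

section Sheaves

variable {X : TopCat.{u}} [ReducedComplexSpace X]

/-- Holomorphic functions on `U`, i.e. `f ∈ 𝒪_X(U)`. -/
abbrev IsHol {U : Opens X} (f : U → ℂ) : Prop := (ReducedComplexSpace.hol (X := X)).pred f

/-- Sections of `𝒪_X[[b]]` on `U`: all the coefficients are in `𝒪_X(U)`. -/
def IsHolSeries {U : Opens X} (F : U → ℂ⟦X⟧) : Prop :=
  ∀ n : ℕ, IsHol fun x : U => PowerSeries.coeff n (F x)

theorem IsHol.sum {U : Opens X} {ι : Type*} (s : Finset ι) {f : ι → U → ℂ}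
    (h : ∀ i ∈ s, IsHol (f i)) : IsHol fun x => ∑ i ∈ s, f i x := by
  classical
  induction s using Finset.induction_on with
  | empty => simpa using ReducedComplexSpace.const_mem U 0
  | insert i s hi ih =>
    simp only [Finset.sum_insert hi]
    exact ReducedComplexSpace.add_mem (h i (by simp)) (ih fun j hj => h j (by simp [hj]))

theorem IsHolSeries.add {U : Opens X} {F G : U → ℂ⟦X⟧} (hF : IsHolSeries F)
    (hG : IsHolSeries G) : IsHolSeries fun x => F x + G x := fun n => by
  simpa using ReducedComplexSpace.add_mem (hF n) (hG n)

theorem IsHolSeries.sum {U : Opens X} {ι : Type*} (s : Finset ι) {F : ι → U → ℂ⟦X⟧}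
    (h : ∀ i ∈ s, IsHolSeries (F i)) : IsHolSeries fun x => ∑ i ∈ s, F i x := fun n => by
  simpa using IsHol.sum s fun i hi => h i hi n

theorem IsHolSeries.mul {U : Opens X} {F G : U → ℂ⟦X⟧} (hF : IsHolSeries F)
    (hG : IsHolSeries G) : IsHolSeries fun x => F x * G x := fun n => by
  simp only [PowerSeries.coeff_mul]
  exact IsHol.sum _ fun p _ => ReducedComplexSpace.mul_mem (hF p.1) (hG p.2)

theorem IsHolSeries.const (U : Opens X) (S : ℂ⟦X⟧) : IsHolSeries fun _ : U => S :=
  fun _ => ReducedComplexSpace.const_mem _ _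

theorem IsHolSeries.derivative {U : Opens X} {F : U → ℂ⟦X⟧} (hF : IsHolSeries F) :
    IsHolSeries fun x => PowerSeries.derivative ℂ (F x) := fun n => by
  simp only [PowerSeries.coeff_derivative]
  exact ReducedComplexSpace.mul_mem (hF _) (ReducedComplexSpace.const_mem _ _)

theorem IsHolSeries.bbD {U : Opens X} {F : U → ℂ⟦X⟧} (hF : IsHolSeries F) :
    IsHolSeries fun x => bbD (F x) := (IsHolSeries.const U _).mul hF.derivative

theorem IsHolSeries.res {U V : Opens X} (h : V ≤ U) {F : U → ℂ⟦X⟧} (hF : IsHolSeries F) :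
    IsHolSeries fun x : V => F ⟨x, h x.2⟩ := fun n =>
  ReducedComplexSpace.hol.res h.hom _ (hF n)

theorem IsHolSeries.locality {U : Opens X} {F : U → ℂ⟦X⟧}
    (h : ∀ x : U, ∃ (V : Opens X) (_ : x.1 ∈ V) (hV : V ≤ U),
      IsHolSeries fun y : V => F ⟨y, hV y.2⟩) : IsHolSeries F := fun n =>
  ReducedComplexSpace.hol.locality _ fun x =>
    let ⟨V, hx, hV, hF⟩ := h x
    ⟨V, hx, hV.hom, hF n⟩

end Sheaves

/-! ### Sheaves of `𝒪_X`-(a,b)-modules -/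

/-- A sheaf of `𝒪_X`-(a,b)-modules on a reduced complex space: a locally free sheaf `𝔼` of finite
type of `𝒪_X[[b]]`-modules with an action of `a`. As `X` is reduced, a section of such a sheaf is
determined by its values in the fibres `E(x) = 𝔼 / ℳ_x[[b]] 𝔼`, so `𝔼` is given as a subsheaf of
the sheaf of all functions `x ↦ s(x) ∈ E(x)`: locally there are sections `e_1, …, e_k` whose values
are bases of all the fibres, and the sections are the combinations of `e_1, …, e_k` with
coefficients in `𝒪_X[[b]]`. -/
structure ABSheaf (X : TopCat.{u}) [ReducedComplexSpace X] where
  /-- the fibres `E(x)` -/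
  fiber : X → Type v
  [addCommGroup : ∀ x, AddCommGroup (fiber x)]
  [module : ∀ x, Module ℂ⟦X⟧ (fiber x)]
  [abModule : ∀ x, ABModule (fiber x)]
  /-- the sections of `𝔼` -/
  sec : TopCat.LocalPredicate fiber
  a_mem : ∀ {U : Opens X} {s : ∀ x : U, fiber x}, sec.pred s → sec.pred fun x : U => opA (s x)
  locally_free : ∀ x : X, ∃ (U : Opens X) (k : ℕ) (e : ∀ y : U, Module.Basis (Fin k) ℂ⟦X⟧ (fiber y)),
    x ∈ U ∧ ∀ (V : Opens X) (hV : V ≤ U) (s : ∀ y : V, fiber y), sec.pred s ↔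
      ∃ c : Fin k → V → ℂ⟦X⟧, (∀ i, IsHolSeries (c i)) ∧
        ∀ y : V, s y = ∑ i, c i y • e ⟨y, hV y.2⟩ i

attribute [instance] ABSheaf.addCommGroup ABSheaf.module ABSheaf.abModule

section Families

variable {X : TopCat.{u}} [ReducedComplexSpace X]

/-- A holomorphic map `φ : U → Ξ_Λ^{(n-1)}`, i.e. a section on `U` of `⊕_{l,j} 𝒪_X[[b]] e_{l,j}`. -/
def IsHolXi {U : Opens X} {Λ : Finset ℚ} {n : ℕ} (φ : U → Xi Λ n) : Prop :=
  ∀ (l : Λ) (j : Fin n), IsHolSeries fun x : U => φ x l j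

/-- `φ` is a `k`-thematic holomorphic map on `U`: the sheaf `𝔼_φ` generated over `𝒪_X[[b]]` by
the `a^ν φ`, `ν ≥ 0`, is free with basis `φ, a φ, …, a^{k-1} φ`, and its fibre at each `x` is the
(a,b)-module generated by `φ(x)`, of rank `k`. -/
def IsThematic (k : ℕ) {U : Opens X} {Λ : Finset ℚ} {n : ℕ} (φ : U → Xi Λ n) : Prop :=
  IsHolXi φ ∧
  (∀ x : U, LinearIndependent ℂ⟦X⟧ fun j : Fin k => opA^[(j : ℕ)] (φ x)) ∧
  ∀ ν : ℕ, ∃ c : Fin k → U → ℂ⟦X⟧, (∀ j, IsHolSeries (c j)) ∧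
    ∀ x : U, opA^[ν] (φ x) = ∑ j, c j x • opA^[(j : ℕ)] (φ x)

/-- The sections on `V ⊂ U` of the sheaf `𝔼_φ` of a `k`-thematic map `φ` on `U`. -/
def IsThematicSection (k : ℕ) {U : Opens X} {Λ : Finset ℚ} {n : ℕ} (φ : U → Xi Λ n)
    {V : Opens X} (hV : V ≤ U) (t : V → Xi Λ n) : Prop :=
  ∃ c : Fin k → V → ℂ⟦X⟧, (∀ j, IsHolSeries (c j)) ∧
    ∀ y : V, t y = ∑ j, c j y • opA^[(j : ℕ)] (φ ⟨y, hV y.2⟩)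

/-- `𝔼` is a holomorphic family of rank `k` themes: locally on `X` there are a finite set
`Λ ⊂ ]0,1] ∩ ℚ`, a `k`-thematic map `φ : U → Ξ_Λ^{(k-1)}` and an isomorphism `𝔼|_U ≃ 𝔼_φ` of
sheaves of `𝒪_X`-(a,b)-modules, given by its values on the fibres. -/
def ABSheaf.IsHolomorphicFamily (𝔼 : ABSheaf.{u, v} X) (k : ℕ) : Prop :=
  ∀ x : X, ∃ (U : Opens X) (Λ : Finset ℚ) (φ : U → Xi Λ k)
    (ι : ∀ y : U, 𝔼.fiber y →ₗ[ℂ⟦X⟧] Xi Λ k),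
    x ∈ U ∧ (∀ l ∈ Λ, 0 < l ∧ l ≤ 1) ∧ IsThematic k φ ∧
    (∀ y : U, Function.Injective (ι y)) ∧
    (∀ (y : U) (e : 𝔼.fiber y), ι y (opA e) = opA (ι y e)) ∧
    ∀ (V : Opens X) (hV : V ≤ U) (t : V → Xi Λ k), IsThematicSection k φ hV t ↔
      ∃ s : ∀ y : V, 𝔼.fiber y, 𝔼.sec.pred s ∧ ∀ y : V, ι ⟨y, hV y.2⟩ (s y) = t y

/-- The sections over `U` of the sheaf `𝔼* = ℋom(𝔼, 𝒪_X[[b]])`: the families of linear forms on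
the fibres that map sections of `𝔼` to sections of `𝒪_X[[b]]`. -/
def ABSheaf.dualSec (𝔼 : ABSheaf.{u, v} X) :
    TopCat.LocalPredicate fun x : X => ABDual (𝔼.fiber x) where
  pred {U} σ := ∀ (V : Opens X) (hV : V ≤ U) (s : ∀ y : V, 𝔼.fiber y), 𝔼.sec.pred s →
    IsHolSeries fun y : V => (σ ⟨y, hV y.2⟩ (s y)).series
  res {_ _} i σ h V hV s hs := h V (hV.trans i.le) s hs
  locality {U} σ h V hV s hs := by
    apply IsHolSeries.locality
    intro x
    obtain ⟨W, hxW, i, hW⟩ := h ⟨x, hV x.2⟩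
    exact ⟨V ⊓ W, ⟨x.2, hxW⟩, inf_le_left, hW (V ⊓ W) inf_le_right
      (fun y => s ⟨y, y.2.1⟩) (𝔼.sec.res (inf_le_left (b := W)).hom _ hs)⟩

/-- The dual basis. -/
def dualB {E : Type v} [AddCommGroup E] [Module ℂ⟦X⟧ E] {k : ℕ}
    (e : Module.Basis (Fin k) ℂ⟦X⟧ E) : Module.Basis (Fin k) ℂ⟦X⟧ (ABDual E) := e.dualBasis

theorem dualB_pairing {E : Type v} [AddCommGroup E] [Module ℂ⟦X⟧ E] {k : ℕ}
    (e : Module.Basis (Fin k) ℂ⟦X⟧ E) (c d : Fin k → ℂ⟦X⟧) :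
    ((∑ i, c i • dualB e i) (∑ j, d j • e j)).series = ∑ i, c i * d i := by
  change (∑ i, c i • e.dualBasis i : Module.Dual ℂ⟦X⟧ E) (∑ j, d j • e j) = _
  simp [LinearMap.sum_apply, Finsupp.single_apply, mul_comm]

theorem dualB_expand {E : Type v} [AddCommGroup E] [Module ℂ⟦X⟧ E] {k : ℕ}
    (e : Module.Basis (Fin k) ℂ⟦X⟧ E) (σ : ABDual E) :
    σ = ∑ i, (σ (e i)).series • dualB e i := by
  refine e.ext fun j => ?_
  have h := dualB_pairing e (fun i => (σ (e i)).series) (Pi.single j 1)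
  simp only [Pi.single_apply, ite_smul, one_smul, zero_smul, Finset.sum_ite_eq',
    Finset.mem_univ, if_true, mul_ite, mul_one, mul_zero] at h
  exact h.symm

/-- The dual family `E(x)*`, `x ∈ X`. -/
def ABSheaf.dual (𝔼 : ABSheaf.{u, v} X) : ABSheaf.{u, v} X where
  fiber x := ABDual (𝔼.fiber x)
  sec := 𝔼.dualSec
  a_mem {U σ} h V hV s hs := by
    have h1 : IsHolSeries fun y : V => rankOneA 0 (σ ⟨y, hV y.2⟩ (s y)).series :=
      (h V hV s hs).bbD.add ((IsHolSeries.const V _).mul (h V hV s hs))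
    have h2 : IsHolSeries fun y : V => (σ ⟨y, hV y.2⟩ (opA (s y))).series :=
      h V hV (fun y => opA (s y)) (𝔼.a_mem hs)
    have h3 := h1.add ((IsHolSeries.const V (-1)).mul h2)
    have h4 : ∀ A B : ℂ⟦X⟧, A + -1 * B = A - B := fun A B => by ring
    have h5 : (fun y : V => ((opA (σ ⟨y, hV y.2⟩)) (s y)).series) = fun y : V =>
        rankOneA 0 (σ ⟨y, hV y.2⟩ (s y)).series + -1 * (σ ⟨y, hV y.2⟩ (opA (s y))).series :=
      funext fun y => (h4 _ _).symm
    change IsHolSeries fun y : V => ((opA (σ ⟨y, hV y.2⟩)) (s y)).series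
    rw [h5]
    exact h3
  locally_free x := by
    obtain ⟨U, k, e, hx, he⟩ := 𝔼.locally_free x
    refine ⟨U, k, fun y => dualB (e y), hx, fun V hV σ => ⟨fun h => ?_, ?_⟩⟩
    · refine ⟨fun i y => (σ y (e ⟨y, hV y.2⟩ i)).series, fun i => ?_,
        fun y => dualB_expand (e ⟨y, hV y.2⟩) (σ y)⟩
      refine h V le_rfl (fun y => e ⟨y, hV y.2⟩ i) ((he V hV _).2
        ⟨fun j _ => if j = i then 1 else 0, fun j => IsHolSeries.const V _, fun y => ?_⟩)
      simp
    · rintro ⟨c, hc, hσ⟩ W hW s hs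
      obtain ⟨d, hd, hsd⟩ := (he W (hW.trans hV) s).1 hs
      have h1 : IsHolSeries fun y : W => ∑ i, c i ⟨y, hW y.2⟩ * d i y :=
        IsHolSeries.sum _ fun i _ => ((hc i).res hW).mul (hd i)
      have h2 : (fun y : W => (σ ⟨y, hW y.2⟩ (s y)).series) =
          fun y : W => ∑ i, c i ⟨y, hW y.2⟩ * d i y := by
        funext y
        rw [hσ, hsd]
        exact dualB_pairing (e ⟨y, hV (hW y.2)⟩) (fun i => c i ⟨y, hW y.2⟩) (fun i => d i y)
      rw [h2]
      exact h1

/-- `x ⊗ S e_δ ↦ S x`, the `ℂ[[b]]`-linear isomorphism `E ⊗ E_δ ≃ E`. -/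
def untwist (δ : ℚ) (E : Type v) [AddCommGroup E] [Module ℂ⟦X⟧ E] :
    E ⊗[ℂ⟦X⟧] RankOne δ ≃ₗ[ℂ⟦X⟧] E := TensorProduct.rid ℂ⟦X⟧ E

theorem untwist_tmul (δ : ℚ) (E : Type v) [AddCommGroup E] [Module ℂ⟦X⟧ E] (x : E)
    (S : RankOne δ) : untwist δ E (x ⊗ₜ[ℂ⟦X⟧] S) = S.series • x := rfl

theorem untwist_a (δ : ℚ) (E : Type v) [AddCommGroup E] [Module ℂ⟦X⟧ E] [ABModule E]
    (t : E ⊗[ℂ⟦X⟧] RankOne δ) :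
    untwist δ E (opA t) = opA (untwist δ E t) +
      (PowerSeries.C (δ : ℂ) * PowerSeries.X) • untwist δ E t := by
  induction t with
  | zero => simp
  | tmul x S =>
    change untwist δ E (tensorA (x ⊗ₜ[ℂ⟦X⟧] S)) = _
    rw [tensorA_tmul, map_add, untwist_tmul, untwist_tmul, untwist_tmul, ABModule.a_smul]
    change _ + rankOneA δ S.series • x = _
    rw [rankOneA, add_smul, mul_smul _ S.series, add_assoc]
  | add s t hs ht => simp only [map_add, hs, ht, smul_add]; abel

theorem ABSheaf.add_mem (𝔼 : ABSheaf.{u, v} X) {U : Opens X} {s t : ∀ x : U, 𝔼.fiber x}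
    (hs : 𝔼.sec.pred s) (ht : 𝔼.sec.pred t) : 𝔼.sec.pred fun x => s x + t x := by
  apply 𝔼.sec.locality
  intro x
  obtain ⟨W, k, e, hx, he⟩ := 𝔼.locally_free x.1
  refine ⟨U ⊓ W, ⟨x.2, hx⟩, (inf_le_left (b := W)).hom, (he _ inf_le_right _).2 ?_⟩
  obtain ⟨c, hc, hsc⟩ := (he _ inf_le_right _).1 (𝔼.sec.res (inf_le_left (b := W)).hom _ hs)
  obtain ⟨d, hd, htd⟩ := (he _ inf_le_right _).1 (𝔼.sec.res (inf_le_left (b := W)).hom _ ht)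
  refine ⟨fun i y => c i y + d i y, fun i => (hc i).add (hd i), fun y => ?_⟩
  simp only [add_smul, Finset.sum_add_distrib, ← hsc, ← htd]

theorem ABSheaf.smul_mem (𝔼 : ABSheaf.{u, v} X) {U : Opens X} {F : U → ℂ⟦X⟧}
    {s : ∀ x : U, 𝔼.fiber x} (hF : IsHolSeries F) (hs : 𝔼.sec.pred s) :
    𝔼.sec.pred fun x => F x • s x := by
  apply 𝔼.sec.locality
  intro x
  obtain ⟨W, k, e, hx, he⟩ := 𝔼.locally_free x.1
  refine ⟨U ⊓ W, ⟨x.2, hx⟩, (inf_le_left (b := W)).hom, (he _ inf_le_right _).2 ?_⟩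
  obtain ⟨c, hc, hsc⟩ := (he _ inf_le_right _).1 (𝔼.sec.res (inf_le_left (b := W)).hom _ hs)
  refine ⟨fun i y => F ⟨y, y.2.1⟩ * c i y,
    fun i => (hF.res (inf_le_left (b := W))).mul (hc i), fun y => ?_⟩
  simp only [mul_smul, ← Finset.smul_sum, ← hsc]
  rfl

/-- The family `E(x) ⊗_{a,b} E_δ`, `x ∈ X`: its sections are the `s ⊗ e_δ`, `s` a section
of `𝔼`. -/
def ABSheaf.twist (𝔼 : ABSheaf.{u, v} X) (δ : ℚ) : ABSheaf.{u, v} X where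
  fiber x := 𝔼.fiber x ⊗[ℂ⟦X⟧] RankOne δ
  sec :=
    { pred := fun {U} σ => 𝔼.sec.pred fun x : U => untwist δ (𝔼.fiber x) (σ x)
      res := fun i _ h => 𝔼.sec.res i _ h
      locality := fun _ h => 𝔼.sec.locality _ h }
  a_mem h := by
    simp only [untwist_a]
    exact 𝔼.add_mem (𝔼.a_mem h) (𝔼.smul_mem (IsHolSeries.const _ _) h)
  locally_free x := by
    obtain ⟨U, k, e, hx, he⟩ := 𝔼.locally_free x
    refine ⟨U, k, fun y => (e y).map (untwist δ _).symm, hx, fun V hV σ => ?_⟩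
    refine (he V hV _).trans (exists_congr fun c => and_congr_right fun _ =>
      forall_congr' fun y => ?_)
    rw [← (untwist δ (𝔼.fiber y)).injective.eq_iff (a := σ y)]
    simp

end Families

end Themes

end

open Themes
open scoped TensorProduct

noncomputable section

namespace Themes

/-! ### Holomorphic functions and series: continuity, inverses, determinants, division. -/

section Holomorphic

variable {X : TopCat.{u}} [ReducedComplexSpace X]

/-! Near a point, choose a frame `e` of the family and an embedding in `Ξ_Λ`. Since the fibres are
`[l]`-primitive, the embedding takes its values in `Ξ_l`, so it is given by a holomorphic `k × k`
matrix `M` with `det M ≠ 0` and `b² M' + M J = C M`; here `J` is the matrix of `a` on `Ξ_l` and `C`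
that of `a` in the frame (`exists_fundamental`).

The inverse of `M` should embed the twisted dual, up to a power of `b`. The columns of `M`, read in
`E* ⊗ E_δ`, span a Jordan block of exponent `δ - l`. An embedding of the theme `E* ⊗ E_δ` in some
`Ξ` must send them to `b^q` times constant vectors, where `δ - l = q + l'` with `l' ∈ ]0,1]`. Hence
`H = b^q M⁻¹` has no pole, and `H`, with indices reversed and signs alternated, embeds `E* ⊗ E_δ` in
`Ξ_{l'}` (`exists_mul_eq_X_pow`, `dualEmbedding_dualAct`). The integer `q` depends only on `δ - l`,
hence not on the point.

So far this is pointwise. For `H` to be holomorphic, one divides `b^q adj M` by `det M`, which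
requires the order in `b` of `det M` to be locally constant. By Jacobi's formula, `d = det M`
satisfies `b² d' = (tr C - k l b) d`, so its order is the coefficient of `b` in `tr C - k l b`: a
continuous function with integer values (`exists_order_det_const`, `IsHolSeries.of_mul`).

Finally, being a generator is an open condition. A generator at one point extends to a section `s`
with constant coordinates, and `s, a s, …, a^{k-1} s` remain a frame nearby, because independence
modulo `b` is the nonvanishing of a holomorphic function (`constantCoeff_det_ne_zero`,
`IsFrame.exists_isThematic`). -/

theorem IsHol.continuous {U : Opens X} {f : U → ℂ} (hf : IsHol f) : Continuous f := by
  rw [continuous_iff_continuousAt]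
  intro x
  obtain ⟨W, n, m, Z, g, z, hxW, -, -, hz, -, hchart⟩ := ReducedComplexSpace.chart x.1
  have h1 := (hchart (U ⊓ W) inf_le_right fun y => f ⟨y, y.2.1⟩).1
    (ReducedComplexSpace.hol.res (inf_le_left (b := W)).hom _ hf)
  obtain ⟨N, G, hN, hxN, hG, hfG⟩ := h1 ⟨x, x.2, hxW⟩
  have hc : ContinuousAt (fun y : (U ⊓ W : Opens X) => f ⟨y, y.2.1⟩) ⟨x, x.2, hxW⟩ := by
    have hzc : Continuous fun y : (U ⊓ W : Opens X) => z ⟨y, y.2.2⟩ :=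
      hz.continuous.comp (continuous_subtype_val.subtype_mk _)
    have h2 : ContinuousAt (fun y : (U ⊓ W : Opens X) => G (z ⟨y, y.2.2⟩)) ⟨x, x.2, hxW⟩ :=
      ContinuousAt.comp (f := fun y : (U ⊓ W : Opens X) => z ⟨y, y.2.2⟩)
        ((hG.differentiableAt (hN.mem_nhds hxN)).continuousAt) hzc.continuousAt
    refine h2.congr ?_
    filter_upwards [hzc.continuousAt.preimage_mem_nhds (hN.mem_nhds hxN)] with y hy
    exact (hfG y hy).symm
  have ho : Topology.IsOpenEmbedding
      (fun y : (U ⊓ W : Opens X) => (⟨y, y.2.1⟩ : U)) :=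
    Opens.isOpenEmbedding_of_le inf_le_left
  exact (ho.continuousAt_iff (x := ⟨x, x.2, hxW⟩) (g := f)).1 hc

theorem IsHol.inv {U : Opens X} {f : U → ℂ} (hf : IsHol f) (h0 : ∀ x, f x ≠ 0) :
    IsHol fun x => (f x)⁻¹ := by
  apply ReducedComplexSpace.hol.locality
  intro x
  obtain ⟨W, n, m, Z, g, z, hxW, -, -, hz, -, hchart⟩ := ReducedComplexSpace.chart x.1
  refine ⟨U ⊓ W, ⟨x.2, hxW⟩, (inf_le_left (b := W)).hom, ?_⟩
  refine (hchart (U ⊓ W) inf_le_right _).2 fun y => ?_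
  have h1 := (hchart (U ⊓ W) inf_le_right fun y => f ⟨y, y.2.1⟩).1
    (ReducedComplexSpace.hol.res (inf_le_left (b := W)).hom _ hf)
  obtain ⟨N, G, hN, hyN, hG, hfG⟩ := h1 y
  refine ⟨N ∩ G ⁻¹' {0}ᶜ, fun w => (G w)⁻¹,
    hG.continuousOn.isOpen_inter_preimage hN isOpen_compl_singleton, ⟨hyN, ?_⟩,
    (hG.mono Set.inter_subset_left).inv fun w hw => hw.2, fun y' hy' => ?_⟩
  · have := h0 ⟨y, y.2.1⟩
    rw [hfG y hyN] at this
    exact this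
  · exact congrArg _ (hfG y' hy'.1)

theorem IsHolSeries.neg {U : Opens X} {F : U → ℂ⟦X⟧} (hF : IsHolSeries F) :
    IsHolSeries fun x => -F x := by
  simpa using (IsHolSeries.const U (-1)).mul hF

theorem IsHolSeries.sub {U : Opens X} {F G : U → ℂ⟦X⟧} (hF : IsHolSeries F)
    (hG : IsHolSeries G) : IsHolSeries fun x => F x - G x := by
  simpa [sub_eq_add_neg] using hF.add hG.neg

theorem IsHolSeries.finset_prod {U : Opens X} {ι : Type*} (s : Finset ι) {F : ι → U → ℂ⟦X⟧}
    (h : ∀ i ∈ s, IsHolSeries (F i)) : IsHolSeries fun x => ∏ i ∈ s, F i x := by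
  classical
  induction s using Finset.induction_on with
  | empty => simpa using IsHolSeries.const U 1
  | insert i s hi ih =>
    simp only [Finset.prod_insert hi]
    exact (h i (by simp)).mul (ih fun j hj => h j (by simp [hj]))

/-- The coefficients of the inverse are given recursively by polynomials in those of `F` and in the
inverse of the constant term. -/
theorem IsHolSeries.inv {U : Opens X} {F : U → ℂ⟦X⟧} (hF : IsHolSeries F)
    (h0 : ∀ x, PowerSeries.coeff 0 (F x) ≠ 0) : IsHolSeries fun x => (F x)⁻¹ := by
  intro n
  induction n using Nat.strong_induction_on with
  | _ n ih =>
    have hinv := (hF 0).inv h0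
    rcases Nat.eq_zero_or_pos n with rfl | hn
    · simpa using hinv
    · have h1 : IsHol fun x : U => ∑ p ∈ Finset.HasAntidiagonal.antidiagonal n,
          if p.2 < n then PowerSeries.coeff p.1 (F x) * PowerSeries.coeff p.2 (F x)⁻¹ else 0 := by
        refine IsHol.sum _ fun p _ => ?_
        split_ifs with hp
        · exact ReducedComplexSpace.mul_mem (hF _) (ih _ hp)
        · exact ReducedComplexSpace.const_mem _ _
      have h2 := ReducedComplexSpace.mul_mem
        (ReducedComplexSpace.mul_mem (ReducedComplexSpace.const_mem U (-1)) hinv) h1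
      have h3 : (fun x => PowerSeries.coeff n (F x)⁻¹) = fun x : U =>
          -1 * (PowerSeries.coeff 0 (F x))⁻¹ * ∑ p ∈ Finset.HasAntidiagonal.antidiagonal n,
            if p.2 < n then PowerSeries.coeff p.1 (F x) * PowerSeries.coeff p.2 (F x)⁻¹ else 0 := by
        funext x
        rw [PowerSeries.coeff_inv, if_neg hn.ne', PowerSeries.coeff_zero_eq_constantCoeff_apply,
          neg_one_mul]
      exact h3 ▸ h2

theorem IsHolSeries.det {U : Opens X} {k : ℕ} {M : U → Matrix (Fin k) (Fin k) ℂ⟦X⟧}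
    (hM : ∀ i j, IsHolSeries fun x => M x i j) : IsHolSeries fun x => (M x).det := by
  simp only [Matrix.det_apply']
  exact IsHolSeries.sum _ fun σ _ => (IsHolSeries.const U _).mul
    (IsHolSeries.finset_prod _ fun i _ => hM _ _)

theorem IsHolSeries.adjugate {U : Opens X} {k : ℕ} {M : U → Matrix (Fin k) (Fin k) ℂ⟦X⟧}
    (hM : ∀ i j, IsHolSeries fun x => M x i j) (i j : Fin k) :
    IsHolSeries fun x => (M x).adjugate i j := by
  simp only [Matrix.adjugate_apply]
  refine IsHolSeries.det fun p q => ?_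
  by_cases h : p = j
  · subst h
    simpa using IsHolSeries.const U _
  · simpa [Matrix.updateRow_ne h] using hM p q

theorem IsHolSeries.of_X_pow_mul {U : Opens X} {F : U → ℂ⟦X⟧} (m : ℕ)
    (hF : IsHolSeries fun x => PowerSeries.X ^ m * F x) : IsHolSeries F := fun n => by
  simpa [PowerSeries.coeff_X_pow_mul] using hF (n + m)

/-- If `G = F H` and the order `m` of the series `F x ≠ 0` is constant, then `H` is holomorphic
with `F` and `G`. -/
theorem IsHolSeries.of_mul {U : Opens X} {F G H : U → ℂ⟦X⟧} (m : ℕ) (hF : IsHolSeries F)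
    (hG : IsHolSeries G) (hlow : ∀ x, ∀ n < m, PowerSeries.coeff n (F x) = 0)
    (hm : ∀ x, PowerSeries.coeff m (F x) ≠ 0) (h : ∀ x, F x * H x = G x) : IsHolSeries H := by
  have hdvd : ∀ x, ∃ u, F x = PowerSeries.X ^ m * u := fun x =>
    PowerSeries.X_pow_dvd_iff.2 (hlow x)
  choose u hu using hdvd
  have hu1 : IsHolSeries u := IsHolSeries.of_X_pow_mul m (by simpa only [← hu] using hF)
  have hu0 : ∀ x, PowerSeries.coeff 0 (u x) ≠ 0 := fun x => by
    have := hm x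
    rw [hu] at this
    simpa [PowerSeries.coeff_X_pow_mul'] using this
  refine IsHolSeries.of_X_pow_mul m ?_
  have h1 : (fun x => PowerSeries.X ^ m * H x) = fun x => (u x)⁻¹ * G x := by
    funext x
    have h2 : (u x)⁻¹ * u x = 1 := PowerSeries.inv_mul_cancel _ (by simpa using hu0 x)
    rw [← h, hu]
    calc _ = (((u x)⁻¹ * u x)) * (PowerSeries.X ^ m * H x) := by rw [h2, one_mul]
      _ = _ := by ring
  rw [h1]
  exact (hu1.inv hu0).mul hG

end Holomorphic

/-! ### The determinant of a fundamental matrix -/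

theorem bbD_sum {ι : Type*} (s : Finset ι) (f : ι → ℂ⟦X⟧) :
    bbD (∑ i ∈ s, f i) = ∑ i ∈ s, bbD (f i) :=
  map_sum (AddMonoidHom.mk' bbD bbD_add) f s

@[simp] theorem bbD_C (c : ℂ) : bbD (PowerSeries.C c) = 0 := by
  simp [bbD]

@[simp] theorem bbD_zero : bbD 0 = 0 := by simp [bbD]

@[simp] theorem bbD_one : bbD 1 = 0 := by simp [bbD]

theorem coeff_bbD_succ (S : ℂ⟦X⟧) (n : ℕ) :
    PowerSeries.coeff (n + 1) (bbD S) = n * PowerSeries.coeff n S := by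
  rw [bbD, PowerSeries.coeff_X_pow_mul']
  rcases n with _ | n
  · simp
  · simp [PowerSeries.coeff_derivative, mul_comm]

@[simp] theorem coeff_bbD_zero (S : ℂ⟦X⟧) : PowerSeries.coeff 0 (bbD S) = 0 := by
  simp [bbD]

theorem bbD_X_pow (m : ℕ) :
    bbD (PowerSeries.X ^ m) = PowerSeries.C (m : ℂ) * PowerSeries.X * PowerSeries.X ^ m := by
  ext n
  rcases n with _ | n
  · simp
  · rw [coeff_bbD_succ, mul_assoc, PowerSeries.coeff_C_mul, PowerSeries.coeff_succ_X_mul,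
      PowerSeries.coeff_X_pow]
    split_ifs with h <;> simp [h]

theorem bbD_prod {ι : Type*} [DecidableEq ι] (s : Finset ι) (f : ι → ℂ⟦X⟧) :
    bbD (∏ i ∈ s, f i) = ∑ i ∈ s, bbD (f i) * ∏ j ∈ s.erase i, f j := by
  induction s using Finset.induction_on with
  | empty => simp
  | insert i s hi ih =>
    rw [Finset.prod_insert hi, bbD_mul, ih, Finset.sum_insert hi, Finset.erase_insert hi,
      add_comm, Finset.mul_sum]
    congr 1
    refine Finset.sum_congr rfl fun j hj => ?_
    have hij : i ≠ j := fun h => hi (h ▸ hj)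
    rw [Finset.erase_insert_of_ne hij, Finset.prod_insert (by simp [hi])]
    ring

/-- Jacobi's formula for the derivation `b² d/db`. -/
theorem bbD_det {k : ℕ} (M : Matrix (Fin k) (Fin k) ℂ⟦X⟧) :
    bbD M.det = (M.adjugate * M.map bbD).trace := by
  -- By Cramer's rule, the trace is the sum over the columns of the determinants with one column
  -- differentiated.
  have h1 : ∀ i, (M.adjugate * M.map bbD) i i =
      (M.updateCol i fun p => bbD (M p i)).det := fun i => by
    rw [← Matrix.cramer_apply, Matrix.cramer_eq_adjugate_mulVec]
    simp [Matrix.mul_apply, Matrix.mulVec, dotProduct]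
  rw [Matrix.trace]
  simp only [Matrix.diag_apply, h1]
  simp only [Matrix.det_apply', bbD_sum]
  rw [Finset.sum_comm]
  refine Finset.sum_congr rfl fun σ _ => ?_
  have h2 : ∀ c : ℤ, bbD (c : ℂ⟦X⟧) = 0 := fun c => by
    rw [← map_intCast (PowerSeries.C (R := ℂ)), bbD_C]
  rw [bbD_mul, h2, zero_mul, add_zero, bbD_prod, Finset.mul_sum]
  refine Finset.sum_congr rfl fun i _ => ?_
  congr 1
  rw [← Finset.mul_prod_erase _ _ (Finset.mem_univ i), Matrix.updateCol_self]
  congr 1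
  exact Finset.prod_congr rfl fun j hj => by
    rw [Matrix.updateCol_ne (Finset.ne_of_mem_erase hj)]

/-- A nonzero solution of `b² d' = T d` has an order determined by the coefficient of `b`
in `T`. -/
theorem coeff_one_eq_order {d T : ℂ⟦X⟧} (h : bbD d = T * d) {m : ℕ}
    (hlow : ∀ n < m, PowerSeries.coeff n d = 0) (hm : PowerSeries.coeff m d ≠ 0) :
    PowerSeries.coeff 1 T = m := by
  obtain ⟨u, rfl⟩ := PowerSeries.X_pow_dvd_iff.2 hlow
  have hu : PowerSeries.coeff 0 u ≠ 0 := by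
    simpa [PowerSeries.coeff_X_pow_mul'] using hm
  have hX : (PowerSeries.X : ℂ⟦X⟧) ^ m ≠ 0 := pow_ne_zero _ PowerSeries.X_ne_zero
  -- Write `d = b^m u` with `u` a unit and cancel `b^m`. The constant term of the result gives `b ∣
  -- T`; after division by `b`, the constant term compares `m` with the coefficient sought.
  have h1 : bbD u + PowerSeries.C (m : ℂ) * PowerSeries.X * u = T * u := by
    apply mul_left_cancel₀ hX
    rw [bbD_mul, bbD_X_pow] at h
    linear_combination h
  have h2 := congrArg PowerSeries.constantCoeff h1
  have h3 : PowerSeries.constantCoeff T = 0 := by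
    have : PowerSeries.constantCoeff T = 0 ∨ PowerSeries.constantCoeff u = 0 := by
      simpa [bbD] using h2.symm
    exact this.resolve_right (by simpa using hu)
  obtain ⟨T, rfl⟩ := PowerSeries.X_dvd_iff.2 h3
  have h4 : PowerSeries.X * PowerSeries.derivative ℂ u + PowerSeries.C (m : ℂ) * u = T * u := by
    apply mul_left_cancel₀ PowerSeries.X_ne_zero
    rw [bbD] at h1
    linear_combination h1
  have h5 : (m : ℂ) * PowerSeries.constantCoeff u =
      PowerSeries.constantCoeff T * PowerSeries.constantCoeff u := by
    simpa using congrArg PowerSeries.constantCoeff h4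
  rw [show (1 : ℕ) = 0 + 1 from rfl, PowerSeries.coeff_succ_X_mul]
  simpa using (mul_right_cancel₀ (by simpa using hu) h5).symm

/-! ### Homomorphisms into the modules of asymptotic expansions -/

section Horizontal

variable {Λ : Finset ℚ} {n : ℕ}

theorem opA_apply (t : Xi Λ n) (μ : Λ) (i : Fin n) : opA t μ i =
    bbD (t μ i) + PowerSeries.C ((μ : ℚ) : ℂ) * PowerSeries.X * t μ i +
      if h : (i : ℕ) + 1 < n then PowerSeries.X * t μ ⟨i + 1, h⟩ else 0 := rfl

/-- If `a t = ρ b t + b t'`, then the exponents of the terms of `t` are equal to `ρ` as soon as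
those of `t'` are. -/
theorem exponent_eq_of_opA_eq {ρ : ℚ} {t t' : Xi Λ n}
    (h : opA t = (PowerSeries.C (ρ : ℂ) * PowerSeries.X) • t + (PowerSeries.X : ℂ⟦X⟧) • t')
    (ht' : ∀ (μ : Λ) i m, PowerSeries.coeff m (t' μ i) ≠ 0 → (m : ℚ) + μ = ρ)
    (μ : Λ) (i : Fin n) (m : ℕ) (hm : PowerSeries.coeff m (t μ i) ≠ 0) : (m : ℚ) + μ = ρ := by
  by_contra hne
  -- Descending induction on `i`, since the component `i` of `a t` involves the component `i + 1` of
  -- `t`. The coefficient of `b^(m+1)` then reads `(m + μ - ρ) t_m = 0`.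
  have key : ∀ d : ℕ, ∀ i : Fin n, n - i = d → PowerSeries.coeff m (t μ i) = 0 := by
    intro d
    induction d with
    | zero => intro i hi; omega
    | succ d ih =>
      intro i hi
      have h1 := congrArg (PowerSeries.coeff (m + 1)) (congrFun (congrFun h μ) i)
      rw [opA_apply] at h1
      have h2 : PowerSeries.coeff (m + 1)
          (if h : (i : ℕ) + 1 < n then PowerSeries.X * t μ ⟨i + 1, h⟩ else 0) = 0 := by
        split_ifs with hin
        · rw [PowerSeries.coeff_succ_X_mul]
          exact ih _ (by simp only; omega)
        · simp
      have h3 : PowerSeries.coeff m (t' μ i) = 0 := by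
        by_contra h4
        exact hne (ht' μ i m h4)
      simp only [map_add, h2, Pi.add_apply, Pi.smul_apply, smul_eq_mul, coeff_bbD_succ, mul_assoc,
        PowerSeries.coeff_C_mul, PowerSeries.coeff_succ_X_mul, h3, add_zero] at h1
      have h5 : ((m : ℂ) + (μ : ℚ) - ρ) * PowerSeries.coeff m (t μ i) = 0 := by
        linear_combination h1
      refine (mul_eq_zero.1 h5).resolve_left fun h6 => hne ?_
      have h7 : (((m : ℚ) + μ : ℚ) : ℂ) = (ρ : ℚ) := by
        push_cast
        linear_combination h6
      exact_mod_cast h7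
  exact hm (key _ i rfl)

/-- A rational number has at most one decomposition into a natural number and a remainder in
`]0,1]`. -/
theorem natCast_add_inj {l l' : ℚ} (hl : 0 < l ∧ l ≤ 1) (hl' : 0 < l' ∧ l' ≤ 1) {m m' : ℕ}
    (h : (m : ℚ) + l = m' + l') : m = m' ∧ l = l' := by
  have h1 : m = m' := by
    rcases lt_trichotomy m m' with h2 | h2 | h2
    · have : (m : ℚ) + 1 ≤ m' := by exact_mod_cast h2
      linarith
    · exact h2
    · have : (m' : ℚ) + 1 ≤ m := by exact_mod_cast h2
      linarith
  subst h1
  exact ⟨rfl, by linarith⟩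

/-- A homomorphism from an `[l]`-primitive module to `Ξ_Λ` takes its values in `Ξ_l`. -/
theorem apply_eq_zero_of_primitive {E : Type v} [AddCommGroup E] [Module ℂ⟦X⟧ E] [ABModule E]
    {l : ℚ} (hl : 0 < l ∧ l ≤ 1) (hΛ : ∀ μ ∈ Λ, 0 < μ ∧ μ ≤ 1) {p : ℕ}
    (θ : E →ₗ[ℂ⟦X⟧] Xi {l} p) (hθ : Function.Injective θ) (hθa : ∀ x, θ (opA x) = opA (θ x))
    (g : E →ₗ[ℂ⟦X⟧] Xi Λ n) (hga : ∀ x, g (opA x) = opA (g x)) (x : E) (μ : Λ)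
    (hμ : (μ : ℚ) ≠ l) : g x μ = 0 := by
  let l₀ : ({l} : Finset ℚ) := ⟨l, by simp⟩
  have hl₀ : ∀ ν : ({l} : Finset ℚ), ν = l₀ := fun ν => Subtype.ext (Finset.mem_singleton.1 ν.2)
  -- Induction along the filtration of `E` by the degree in the logarithm: level `j` consists of the
  -- `x` whose image in `Ξ_l` has only components of index `< j`.
  suffices H : ∀ j : ℕ, ∀ x : E, (∀ i : Fin p, j ≤ i → θ x l₀ i = 0) → g x μ = 0 from
    H p x fun i hi => absurd i.2 (by omega)
  intro j
  induction j with
  | zero =>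
    intro x hx
    have : x = 0 := hθ (by
      rw [map_zero]
      funext ν i
      rw [hl₀ ν]
      exact hx i (Nat.zero_le _))
    simp [this]
  | succ j ih =>
    intro x hx
    by_cases hjp : j < p
    swap
    · exact ih x fun i hi => absurd i.2 (by omega)
    by_cases hzero : ∀ y : E, (∀ i : Fin p, j + 1 ≤ i → θ y l₀ i = 0) → θ y l₀ ⟨j, hjp⟩ = 0
    · refine ih x fun i hi => ?_
      rcases Nat.eq_or_lt_of_le hi with h | h
      · have : i = ⟨j, hjp⟩ := Fin.ext h.symm
        rw [this]
        exact hzero x hx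
      · exact hx i h
    push Not at hzero
    classical
    -- Among the leading coefficients at this level, take one of least order `m` and normalise it to
    -- `b^m`. The resulting `x₀` generates the level modulo the previous one.
    have hex : ∃ m : ℕ, ∃ y : E, (∀ i : Fin p, j + 1 ≤ i → θ y l₀ i = 0) ∧
        PowerSeries.coeff m (θ y l₀ ⟨j, hjp⟩) ≠ 0 := by
      obtain ⟨y, hy, hy0⟩ := hzero
      obtain ⟨m, hm⟩ := PowerSeries.exists_coeff_ne_zero_iff_ne_zero.2 hy0
      exact ⟨m, y, hy, hm⟩
    let m := Nat.find hex
    obtain ⟨y, hy, hym⟩ := Nat.find_spec hex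
    have hmin : ∀ z : E, (∀ i : Fin p, j + 1 ≤ i → θ z l₀ i = 0) →
        PowerSeries.X ^ m ∣ θ z l₀ ⟨j, hjp⟩ := fun z hz =>
      PowerSeries.X_pow_dvd_iff.2 fun q hq => by
        by_contra hne
        exact Nat.find_min hex hq ⟨z, hz, hne⟩
    obtain ⟨w, hw⟩ := hmin y hy
    have hw0 : PowerSeries.constantCoeff w ≠ 0 := by
      rw [hw] at hym
      simpa [PowerSeries.coeff_X_pow_mul', m] using hym
    set x₀ : E := w⁻¹ • y with hx₀
    have hx₀m : θ x₀ l₀ ⟨j, hjp⟩ = PowerSeries.X ^ m := by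
      rw [hx₀, map_smul, Pi.smul_apply, Pi.smul_apply, hw, smul_eq_mul, mul_left_comm,
        PowerSeries.inv_mul_cancel _ hw0, mul_one]
    have hx₀z : ∀ i : Fin p, j + 1 ≤ i → θ x₀ l₀ i = 0 := fun i hi => by
      rw [hx₀, map_smul, Pi.smul_apply, Pi.smul_apply, hy i hi, smul_zero]
    clear_value x₀
    have hgx₀ : g x₀ μ = 0 := by
      -- As `a (b^m e_{l,j})` has leading term `(m + l) b^(m+1) e_{l,j}`, the operator `a - (m + l)
      -- b` sends `x₀` to the previous level, where `g` has no component at `μ`.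
      have h1 : ∀ i : Fin p, j ≤ i →
          θ (opA x₀ - (PowerSeries.C ((m + l : ℚ) : ℂ) * PowerSeries.X) • x₀) l₀ i = 0 := by
        intro i hi
        rw [map_sub, map_smul, hθa, Pi.sub_apply, Pi.sub_apply, opA_apply, Pi.smul_apply,
          Pi.smul_apply, smul_eq_mul]
        have h2 : (if h : (i : ℕ) + 1 < p then
            PowerSeries.X * θ x₀ l₀ ⟨i + 1, h⟩ else 0) = 0 := by
          split_ifs with h
          · rw [hx₀z _ (by simpa using hi), mul_zero]
          · rfl
        rw [h2, add_zero]
        rcases Nat.eq_or_lt_of_le hi with h | h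
        · have : i = ⟨j, hjp⟩ := Fin.ext h.symm
          rw [this, hx₀m, bbD_X_pow]
          push_cast
          rw [map_add]
          ring
        · rw [hx₀z i h]
          simp
      have h3 := ih _ h1
      rw [map_sub, map_smul, hga, Pi.sub_apply, sub_eq_zero] at h3
      have h4 : ∀ i q, PowerSeries.coeff q (g x₀ μ i) ≠ 0 → (q : ℚ) + μ = m + l := by
        -- The equation is known for the component at `μ` only, so this component is viewed alone in
        -- `Ξ_μ`. Its exponents equal `m + l`, which forces `μ = l`.
        let t : Xi {(μ : ℚ)} n := fun _ => g x₀ μ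
        intro i q hq
        refine exponent_eq_of_opA_eq (t := t) (t' := 0) (ρ := m + l) ?_ (by simp)
          ⟨μ, by simp⟩ i q hq
        funext ν i
        have hν : (ν : ℚ) = μ := Finset.mem_singleton.1 ν.2
        have h5 := congrFun h3 i
        rw [opA_apply] at h5 ⊢
        rw [hν]
        simpa [t] using h5
      funext i
      ext q
      by_contra hne
      exact hμ (natCast_add_inj (hΛ μ μ.2) hl (h4 i q hne)).2
    obtain ⟨c, hc⟩ := hmin x hx
    have h6 : ∀ i : Fin p, j ≤ i → θ (x - c • x₀) l₀ i = 0 := by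
      intro i hi
      rw [map_sub, map_smul, Pi.sub_apply, Pi.sub_apply, Pi.smul_apply, Pi.smul_apply]
      rcases Nat.eq_or_lt_of_le hi with h | h
      · have : i = ⟨j, hjp⟩ := Fin.ext h.symm
        rw [this, hx₀m, hc, smul_eq_mul, mul_comm, sub_self]
      · rw [hx i h, hx₀z i h, smul_zero, sub_zero]
    have h7 := ih _ h6
    rwa [map_sub, map_smul, Pi.sub_apply, Pi.smul_apply, hgx₀, smul_zero, sub_zero] at h7

end Horizontal

/-! ### The dual of a module given by a fundamental matrix -/

section Matrices

variable {k : ℕ}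

/-- The matrix of `a` on `Ξ_l^{(k-1)}`, acting on row vectors of coefficients. -/
def jordanA (l : ℚ) (k : ℕ) : Matrix (Fin k) (Fin k) ℂ⟦X⟧ := fun p j =>
  (if p = j then PowerSeries.C (l : ℂ) * PowerSeries.X else 0) +
    if (p : ℕ) = j + 1 then PowerSeries.X else 0

theorem sum_mul_jordanA (l : ℚ) (v : Fin k → ℂ⟦X⟧) (j : Fin k) :
    ∑ p, v p * jordanA l k p j = PowerSeries.C (l : ℂ) * PowerSeries.X * v j +
      if h : (j : ℕ) + 1 < k then PowerSeries.X * v ⟨j + 1, h⟩ else 0 := by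
  simp only [jordanA, mul_add, Finset.sum_add_distrib, mul_ite, mul_zero, Finset.sum_ite_eq',
    Finset.mem_univ, if_true]
  congr 1
  · ring
  · split_ifs with h
    · rw [Finset.sum_eq_single ⟨j + 1, h⟩]
      · simp [mul_comm]
      · intro p _ hp
        rw [if_neg]
        exact fun h' => hp (Fin.ext h')
      · simp
    · refine Finset.sum_eq_zero fun p _ => if_neg fun h' => h ?_
      rw [← h']
      exact p.2

/-- On column vectors the nilpotent part of `jordanA` shifts the indices the other way; reversing
them gives back the shape of `a` on `Ξ_l`. -/
theorem jordanA_mulVec_rev (l : ℚ) (v : Fin k → ℂ⟦X⟧) (j : Fin k) :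
    (jordanA l k).mulVec v j.rev = PowerSeries.C (l : ℂ) * PowerSeries.X * v j.rev +
      if h : (j : ℕ) + 1 < k then PowerSeries.X * v (Fin.rev ⟨j + 1, h⟩) else 0 := by
  simp only [Matrix.mulVec, dotProduct, jordanA, add_mul, Finset.sum_add_distrib, ite_mul,
    zero_mul, Finset.sum_ite_eq, Finset.mem_univ, if_true]
  congr 1
  split_ifs with h
  · rw [Finset.sum_eq_single (Fin.rev ⟨j + 1, h⟩)]
    · rw [if_pos]
      simp only [Fin.val_rev]
      omega
    · intro p _ hp
      rw [if_neg]
      refine fun h' => hp (Fin.ext ?_)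
      simp only [Fin.val_rev] at h' ⊢
      omega
    · simp
  · refine Finset.sum_eq_zero fun p _ => if_neg fun h' => h ?_
    simp only [Fin.val_rev] at h'
    omega

theorem trace_jordanA (l : ℚ) (k : ℕ) :
    (jordanA l k).trace = PowerSeries.C ((k * l : ℚ) : ℂ) * PowerSeries.X := by
  simp [Matrix.trace, jordanA]
  ring

theorem map_bbD_mul (A B : Matrix (Fin k) (Fin k) ℂ⟦X⟧) :
    (A * B).map bbD = A * B.map bbD + A.map bbD * B := by
  ext1 i j
  simp [Matrix.mul_apply, bbD_sum, bbD_mul, Finset.sum_add_distrib]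

/-- The action of `a` on `E* ⊗ E_δ` in coordinates with respect to the basis dual to
`e_1, …, e_k`, where `a e_i = ∑ C_ij e_j`. -/
def dualAct (C : Matrix (Fin k) (Fin k) ℂ⟦X⟧) (δ : ℚ) (f : Fin k → ℂ⟦X⟧) : Fin k → ℂ⟦X⟧ :=
  fun i => bbD (f i) - C.mulVec f i + PowerSeries.C (δ : ℂ) * PowerSeries.X * f i

variable {l : ℚ} {M C : Matrix (Fin k) (Fin k) ℂ⟦X⟧}

/-- Jacobi's formula: formally, the trace of `M⁻¹ (C M - M J)` is `tr C - tr J`. -/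
theorem bbD_det_of_fundamental (hM : M.map bbD + M * jordanA l k = C * M) :
    bbD M.det = (C.trace - PowerSeries.C ((k * l : ℚ) : ℂ) * PowerSeries.X) * M.det := by
  have h1 : M.map bbD = C * M - M * jordanA l k := eq_sub_of_add_eq hM
  rw [bbD_det, h1, mul_sub, Matrix.trace_sub, ← mul_assoc, ← mul_assoc, Matrix.trace_mul_comm,
    ← mul_assoc, Matrix.mul_adjugate, Matrix.adjugate_mul, Matrix.smul_mul, Matrix.smul_mul,
    one_mul, one_mul, Matrix.trace_smul, Matrix.trace_smul, trace_jordanA, smul_eq_mul,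
    smul_eq_mul]
  ring

/-- Column `j` is the linear form "coefficient of `e_{l,j}`" on `E`. In the twisted dual these forms
make up a Jordan block of exponent `δ - l`, with the nilpotent part transposed and negated. -/
theorem dualAct_col (hM : M.map bbD + M * jordanA l k = C * M) (δ : ℚ) (j : Fin k) :
    dualAct C δ (fun i => M i j) =
      (PowerSeries.C ((δ - l : ℚ) : ℂ) * PowerSeries.X) • (fun i => M i j) +
      (PowerSeries.X : ℂ⟦X⟧) •
        (if h : (j : ℕ) + 1 < k then (fun i => -M i ⟨j + 1, h⟩) else 0 : Fin k → ℂ⟦X⟧) := by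
  funext i
  have h1 := congrFun (congrFun hM i) j
  rw [Matrix.add_apply, Matrix.map_apply, Matrix.mul_apply, sum_mul_jordanA] at h1
  have h2 : C.mulVec (fun i => M i j) i = (C * M) i j := rfl
  rw [dualAct, h2, ← h1]
  push_cast
  rw [map_sub]
  simp only [Pi.add_apply, Pi.smul_apply, smul_eq_mul]
  split_ifs with h
  · ring
  · simp only [Pi.zero_apply]
    ring

/-- If `E* ⊗ E_δ` embeds in some `Ξ_Λ`, then the inverse of the fundamental matrix of `E` has
a pole of order at most `q`, where `δ - l - q ∈ ]0,1]`. -/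
theorem exists_mul_eq_X_pow [NeZero k] (hM : M.map bbD + M * jordanA l k = C * M)
    (hdet : M.det ≠ 0) {δ : ℚ} {Λ : Finset ℚ} {n : ℕ} (hΛ : ∀ μ ∈ Λ, 0 < μ ∧ μ ≤ 1)
    (θ : (Fin k → ℂ⟦X⟧) →ₗ[ℂ⟦X⟧] Xi Λ n) (hθ : Function.Injective θ)
    (hθa : ∀ f, θ (dualAct C δ f) = opA (θ f)) :
    ∃ (q : ℕ) (l' : ℚ), (0 < l' ∧ l' ≤ 1) ∧ δ - l = q + l' ∧
      ∃ H : Matrix (Fin k) (Fin k) ℂ⟦X⟧, M * H = (PowerSeries.X ^ q : ℂ⟦X⟧) • 1 := by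
  let t : Fin k → Xi Λ n := fun j => θ fun i => M i j
  have ht : ∀ j, opA (t j) = (PowerSeries.C ((δ - l : ℚ) : ℂ) * PowerSeries.X) • t j +
      (PowerSeries.X : ℂ⟦X⟧) • (if h : (j : ℕ) + 1 < k then -t ⟨j + 1, h⟩ else 0) := by
    intro j
    rw [← hθa, dualAct_col hM, map_add, map_smul, map_smul]
    congr 2
    split_ifs with h
    · rw [← map_neg]
      rfl
    · exact map_zero θ
  have hexp : ∀ d : ℕ, ∀ j : Fin k, k - j = d → ∀ (μ : Λ) (i : Fin n) (m : ℕ),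
      PowerSeries.coeff m (t j μ i) ≠ 0 → (m : ℚ) + μ = δ - l := by
    intro d
    induction d with
    | zero => intro j hj; omega
    | succ d ih =>
      intro j hj
      refine exponent_eq_of_opA_eq (ht j) ?_
      intro μ i m hm
      split_ifs at hm with h
      · exact ih ⟨j + 1, h⟩ (by simp only; omega) μ i m (by simpa using hm)
      · simp at hm
  have hexp' : ∀ j μ i m, PowerSeries.coeff m (t j μ i) ≠ 0 → (m : ℚ) + μ = δ - l :=
    fun j => hexp _ j rfl
  have hinj : ∀ v : Fin k → ℂ⟦X⟧, ∑ j, v j • t j = 0 → v = 0 := by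
    intro v hv
    have h1 : θ (M.mulVec v) = 0 := by
      rw [← hv]
      simp only [t, ← map_smul, ← map_sum]
      congr 1
      funext i
      simp [Matrix.mulVec, dotProduct, mul_comm]
    exact Matrix.eq_zero_of_mulVec_eq_zero hdet (hθ (by rw [h1, map_zero]))
  -- If no exponent of `Λ` fitted, the image of the first column would vanish, against the
  -- injectivity; this needs `k ≠ 0`.
  obtain ⟨μ₀, q, hq⟩ : ∃ (μ₀ : Λ) (q : ℕ), (q : ℚ) + μ₀ = δ - l := by
    by_contra! hno
    have h0 : t 0 = 0 := by
      funext μ i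
      ext m
      by_contra hne
      exact hno μ m (hexp' 0 μ i m hne)
    have h1 := hinj (Pi.single 0 1) (by simp [Pi.single_apply, h0])
    simpa using congrFun h1 0
  refine ⟨q, μ₀, hΛ μ₀ μ₀.2, hq.symm, ?_⟩
  -- Only the monomial `b^q` in the components at `μ₀` has the right exponent, so `T` contains all
  -- of the `t j`.
  let T : Matrix (Fin n) (Fin k) ℂ := fun i j => PowerSeries.coeff q (t j μ₀ i)
  have htT : ∀ j i, t j μ₀ i = PowerSeries.X ^ q * PowerSeries.C (T i j) := by
    intro j i
    ext m
    rw [mul_comm, PowerSeries.coeff_C_mul, PowerSeries.coeff_X_pow]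
    split_ifs with h
    · simp [h, T]
    · rw [mul_zero]
      by_contra hne
      exact h (natCast_add_inj (hΛ _ μ₀.2) (hΛ _ μ₀.2) ((hexp' j μ₀ i m hne).trans hq.symm)).1
  have ht0 : ∀ j μ, μ ≠ μ₀ → t j μ = 0 := by
    intro j μ hμ
    funext i
    ext m
    by_contra hne
    exact hμ (Subtype.ext
      (natCast_add_inj (hΛ _ μ.2) (hΛ _ μ₀.2) ((hexp' j μ i m hne).trans hq.symm)).2)
  have hT : Function.Injective T.mulVecLin := by
    rw [← LinearMap.ker_eq_bot, LinearMap.ker_eq_bot']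
    intro v hv
    have h1 := hinj (fun j => PowerSeries.C (v j)) (by
      funext μ i
      simp only [Finset.sum_apply, Pi.smul_apply, smul_eq_mul, Pi.zero_apply]
      by_cases hμ : μ = μ₀
      · subst hμ
        have h2 : ∑ j, T i j * v j = 0 := congrFun hv i
        simp only [htT]
        calc _ = PowerSeries.X ^ q * PowerSeries.C (∑ j, T i j * v j) := by
              rw [map_sum, Finset.mul_sum]
              exact Finset.sum_congr rfl fun j _ => by rw [map_mul]; ring
          _ = 0 := by rw [h2, map_zero, mul_zero]
      · exact Finset.sum_eq_zero fun j _ => by rw [ht0 j μ hμ, Pi.zero_apply, mul_zero])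
    funext j
    simpa using congrArg (PowerSeries.coeff 0) (congrFun h1 j)
  obtain ⟨g, hg⟩ := LinearMap.exists_leftInverse_of_injective T.mulVecLin
    (LinearMap.ker_eq_bot.2 hT)
  let L := LinearMap.toMatrix' g
  have hLT : L * T = 1 := by
    have h1 : LinearMap.toMatrix' (g ∘ₗ T.mulVecLin) = L * T := by
      rw [LinearMap.toMatrix'_comp]
      exact congrArg _ (LinearMap.toMatrix'_toLin' T)
    rw [← h1, hg, LinearMap.toMatrix'_id]
  -- `H` is the matrix of `L ∘ θ`, restricted to the components at `μ₀`. It sends column `j` of `M`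
  -- to `L (b^q T_j)`, which is `b^q` times the basis vector `j`; so `H` is `b^q M⁻¹`.
  let H : Matrix (Fin k) (Fin k) ℂ⟦X⟧ := fun p i =>
    ∑ r, PowerSeries.C (L p r) * θ (Pi.single i 1) μ₀ r
  have hH : M.det • H = (PowerSeries.X ^ q : ℂ⟦X⟧) • M.adjugate := by
    ext1 p i
    have h1 : M.det • θ (Pi.single i 1) = ∑ j, M.adjugate j i • t j := by
      simp only [t, ← map_smul, ← map_sum]
      congr 1
      have h2 : M.det • (Pi.single i 1 : Fin k → ℂ⟦X⟧) =
          (M * M.adjugate).mulVec (Pi.single i 1) := by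
        rw [Matrix.mul_adjugate, Matrix.smul_mulVec, Matrix.one_mulVec]
      rw [h2]
      funext r
      simp [Matrix.mul_apply, mul_comm]
    have h3 : ∀ r, M.det * θ (Pi.single i 1) μ₀ r =
        ∑ j, M.adjugate j i * (PowerSeries.X ^ q * PowerSeries.C (T r j)) := fun r => by
      have := congrFun (congrFun h1 μ₀) r
      simpa [htT] using this
    have h4 : ∀ j, ∑ r, L p r * T r j = (1 : Matrix (Fin k) (Fin k) ℂ) p j := fun j => by
      rw [← hLT, Matrix.mul_apply]
    calc M.det * H p i = ∑ r, PowerSeries.C (L p r) * (M.det * θ (Pi.single i 1) μ₀ r) := by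
          rw [Finset.mul_sum]
          exact Finset.sum_congr rfl fun r _ => by ring
      _ = ∑ j, PowerSeries.X ^ q * M.adjugate j i * PowerSeries.C (∑ r, L p r * T r j) := by
          simp only [h3, Finset.mul_sum, map_sum]
          rw [Finset.sum_comm]
          exact Finset.sum_congr rfl fun j _ => Finset.sum_congr rfl fun r _ => by
            rw [map_mul]; ring
      _ = _ := by simp [h4, Matrix.one_apply]
  refine ⟨H, ?_⟩
  have h5 : M.det • (M * H) = M.det • ((PowerSeries.X ^ q : ℂ⟦X⟧) • 1) := by
    rw [← Matrix.mul_smul, hH, Matrix.mul_smul, Matrix.mul_adjugate, smul_comm]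
  ext1 i j
  exact mul_left_cancel₀ hdet (congrFun (congrFun h5 i) j)

/-- The embedding of `E* ⊗ E_δ` in `Ξ_{l'}`, in coordinates. -/
def dualEmbedding (l' : ℚ) (H : Matrix (Fin k) (Fin k) ℂ⟦X⟧) :
    (Fin k → ℂ⟦X⟧) →ₗ[ℂ⟦X⟧] Xi {l'} k where
  -- The reversal undoes the transposition of the nilpotent part and the alternating signs undo its
  -- negation.
  toFun f := fun _ j => (-1) ^ (j : ℕ) * H.mulVec f j.rev
  map_add' f g := by
    funext _ j
    simp [Matrix.mulVec_add, mul_add]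
  map_smul' c f := by
    funext _ j
    simp only [Matrix.mulVec_smul, Pi.smul_apply, smul_eq_mul, RingHom.id_apply]
    ring

theorem dualEmbedding_apply (l' : ℚ) (H : Matrix (Fin k) (Fin k) ℂ⟦X⟧) (f : Fin k → ℂ⟦X⟧)
    (ν : ({l'} : Finset ℚ)) (j : Fin k) :
    dualEmbedding l' H f ν j = (-1) ^ (j : ℕ) * H.mulVec f j.rev := rfl

theorem dualEmbedding_injective {l' : ℚ} {H : Matrix (Fin k) (Fin k) ℂ⟦X⟧} {q : ℕ}
    (hH : M * H = (PowerSeries.X ^ q : ℂ⟦X⟧) • 1) :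
    Function.Injective (dualEmbedding l' H) := by
  rw [← LinearMap.ker_eq_bot, LinearMap.ker_eq_bot']
  intro f hf
  have h1 : H.mulVec f = 0 := by
    funext j
    have h2 := congrFun (congrFun hf ⟨l', by simp⟩) j.rev
    rw [dualEmbedding_apply, Fin.rev_rev] at h2
    exact (mul_eq_zero.1 h2).resolve_left (pow_ne_zero _ (by simp))
  have h3 : (M * H).mulVec f = 0 := by rw [← Matrix.mulVec_mulVec, h1, Matrix.mulVec_zero]
  rw [hH, Matrix.smul_mulVec, Matrix.one_mulVec] at h3
  exact (smul_eq_zero.1 h3).resolve_left (pow_ne_zero _ PowerSeries.X_ne_zero)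

/-- Differentiate `M H = b^q`, substitute the equation of `M`, and cancel `M`, whose determinant
divides a power of `b`. -/
theorem map_bbD_of_mul_eq_X_pow (hM : M.map bbD + M * jordanA l k = C * M)
    {H : Matrix (Fin k) (Fin k) ℂ⟦X⟧} {q : ℕ} (hH : M * H = (PowerSeries.X ^ q : ℂ⟦X⟧) • 1) :
    H.map bbD = (PowerSeries.C (q : ℂ) * PowerSeries.X) • H - H * C + jordanA l k * H := by
  have hX : (PowerSeries.X ^ q : ℂ⟦X⟧) ≠ 0 := pow_ne_zero _ PowerSeries.X_ne_zero
  have hdet : M.det ≠ 0 := by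
    intro h0
    have h1 := congrArg Matrix.det hH
    rw [Matrix.det_mul, h0, zero_mul, Matrix.det_smul, Matrix.det_one, mul_one] at h1
    exact pow_ne_zero _ hX h1.symm
  have hcancel : ∀ Z : Matrix (Fin k) (Fin k) ℂ⟦X⟧, M * Z = 0 → Z = 0 := by
    intro Z hZ
    have h1 : M.det • Z = 0 := by
      rw [← one_mul Z, ← Matrix.smul_mul, ← Matrix.adjugate_mul, mul_assoc, hZ, mul_zero]
    exact (smul_eq_zero.1 h1).resolve_left hdet
  have hD : M * H.map bbD + M.map bbD * H =
      (PowerSeries.C (q : ℂ) * PowerSeries.X) • (M * H) := by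
    rw [← map_bbD_mul, hH]
    ext1 i j
    simp only [Matrix.map_apply, Matrix.smul_apply, smul_eq_mul, bbD_mul, bbD_X_pow,
      Matrix.one_apply]
    split_ifs <;> simp
  have h2 : M.map bbD = C * M - M * jordanA l k := eq_sub_of_add_eq hM
  refine sub_eq_zero.1 (hcancel _ ?_)
  rw [mul_sub, eq_sub_of_add_eq hD, h2, mul_add, mul_sub, Matrix.mul_smul, ← mul_assoc M H C,
    sub_mul, mul_assoc C M H, hH, mul_assoc M]
  simp only [Matrix.mul_smul, Matrix.smul_mul, mul_one, one_mul]
  abel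

theorem dualEmbedding_dualAct (hM : M.map bbD + M * jordanA l k = C * M)
    {H : Matrix (Fin k) (Fin k) ℂ⟦X⟧} {q : ℕ} (hH : M * H = (PowerSeries.X ^ q : ℂ⟦X⟧) • 1)
    {δ l' : ℚ} (hδ : δ - l = q + l') (f : Fin k → ℂ⟦X⟧) :
    dualEmbedding l' H (dualAct C δ f) = opA (dualEmbedding l' H f) := by
  funext ν j
  have hν : (ν : ℚ) = l' := Finset.mem_singleton.1 ν.2
  have h1 : dualAct C δ f = (fun i => bbD (f i)) - C.mulVec f +
      (PowerSeries.C (δ : ℂ) * PowerSeries.X) • f := rfl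
  have h2 : bbD (H.mulVec f j.rev) =
      H.mulVec (fun i => bbD (f i)) j.rev + (H.map bbD).mulVec f j.rev := by
    simp [Matrix.mulVec, dotProduct, bbD_sum, bbD_mul, Finset.sum_add_distrib]
  rw [map_bbD_of_mul_eq_X_pow hM hH, Matrix.add_mulVec, Matrix.sub_mulVec, Matrix.smul_mulVec,
    ← Matrix.mulVec_mulVec, ← Matrix.mulVec_mulVec, Pi.add_apply, Pi.sub_apply, Pi.smul_apply,
    smul_eq_mul, jordanA_mulVec_rev] at h2
  have h3 : bbD ((-1) ^ (j : ℕ) : ℂ⟦X⟧) = 0 := by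
    rw [show ((-1) ^ (j : ℕ) : ℂ⟦X⟧) = PowerSeries.C ((-1) ^ (j : ℕ)) by simp, bbD_C]
  have h4 : (δ : ℂ) = q + l' + l := by
    have : δ = q + l' + l := by linarith
    rw [this]
    push_cast
    rfl
  rw [opA_apply, hν]
  simp only [dualEmbedding_apply]
  rw [bbD_mul, h3, h2, h1, Matrix.mulVec_add, Matrix.mulVec_sub, Matrix.mulVec_smul, h4,
    map_add, map_add]
  simp only [Pi.add_apply, Pi.sub_apply, Pi.smul_apply, smul_eq_mul]
  split_ifs with h
  · rw [pow_succ]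
    ring
  · ring

end Matrices

/-! ### Cyclic generators -/

/-- If `f` generates `F` and `F` has rank `k`, then `f, a f, …, a^{k-1} f` are independent
modulo `b`. -/
theorem constantCoeff_det_ne_zero {F : Type v} [AddCommGroup F] [Module ℂ⟦X⟧ F] [ABModule F]
    {k : ℕ} (e : Module.Basis (Fin k) ℂ⟦X⟧ F) (f : F)
    (hf : Submodule.span ℂ⟦X⟧ (Set.range fun ν : ℕ => opA^[ν] f) = ⊤) :
    PowerSeries.coeff 0
      (Matrix.of fun i j : Fin k => e.repr (opA^[(j : ℕ)] f) i).det ≠ 0 := by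
  let red : F → Fin k → ℂ := fun x i => PowerSeries.constantCoeff (e.repr x i)
  have red_add : ∀ x y, red (x + y) = red x + red y := fun x y => by
    funext i
    simp [red]
  have red_smul : ∀ (S : ℂ⟦X⟧) x, red (S • x) = PowerSeries.constantCoeff S • red x :=
    fun S x => by
      funext i
      simp [red]
  have red_sum : ∀ g : Fin k → F, red (∑ j, g j) = ∑ j, red (g j) := fun g =>
    map_sum (AddMonoidHom.mk' red red_add) g _
  let A : Matrix (Fin k) (Fin k) ℂ := Matrix.of fun i j => red (opA (e j)) i
  -- Modulo `b` the correction `b² S'` disappears, so `a` induces a `ℂ`-linear map on `F / bF`, with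
  -- matrix `A`.
  have red_opA : ∀ x, red (opA x) = A.mulVec (red x) := fun x => by
    have h1 : opA x = ∑ j, opA (e.repr x j • e j) := by
      rw [← map_sum, e.sum_repr]
    rw [h1, red_sum]
    funext i
    rw [Finset.sum_apply]
    simp only [ABModule.a_smul, red_add, red_smul, Matrix.mulVec, dotProduct, Pi.add_apply,
      Pi.smul_apply, smul_eq_mul]
    refine Finset.sum_congr rfl fun j _ => ?_
    have h2 : PowerSeries.constantCoeff (bbD (e.repr x j)) = 0 := by simp [bbD]
    rw [h2, zero_mul, add_zero, mul_comm]
    rfl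
  have red_iter : ∀ ν : ℕ, red (opA^[ν] f) = (A ^ ν).mulVec (red f) := by
    intro ν
    induction ν with
    | zero => simp
    | succ ν ih => rw [Function.iterate_succ_apply', red_opA, ih, Matrix.mulVec_mulVec, pow_succ']
  set P : Matrix (Fin k) (Fin k) ℂ⟦X⟧ := Matrix.of fun i j => e.repr (opA^[(j : ℕ)] f) i with hP
  let B : Matrix (Fin k) (Fin k) ℂ := PowerSeries.constantCoeff.mapMatrix P
  have hcol : ∀ j : Fin k, B.col j = red (opA^[(j : ℕ)] f) := fun j => rfl
  let W : Submodule ℂ (Fin k → ℂ) := LinearMap.range B.mulVecLin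
  have hWcol : ∀ j : ℕ, j < k → red (opA^[j] f) ∈ W := fun j hj => by
    have : red (opA^[j] f) = B.mulVecLin (Pi.single ⟨j, hj⟩ 1) := by
      rw [← hcol ⟨j, hj⟩]
      simp
    rw [this]
    exact LinearMap.mem_range_self _ _
  have hW : ∀ ν : ℕ, red (opA^[ν] f) ∈ W := by
    intro ν
    rcases Nat.eq_zero_or_pos k with hk | hk
    · subst hk
      rw [Subsingleton.elim (red (opA^[ν] f)) 0]
      exact W.zero_mem
    -- By Cayley–Hamilton, `A^ν` is a combination of the powers of exponent less than `k`; the first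
    -- `k` iterates therefore span `F / bF`.
    have hdeg : (Polynomial.X ^ ν %ₘ A.charpoly).natDegree < k := by
      have h1 : A.charpoly.natDegree = k := by simp [Matrix.charpoly_natDegree_eq_dim]
      refine (Polynomial.natDegree_modByMonic_lt _ A.charpoly_monic fun h2 => ?_).trans_eq h1
      rw [h2, Polynomial.natDegree_one] at h1
      omega
    rw [red_iter, Matrix.pow_eq_aeval_mod_charpoly, Polynomial.aeval_eq_sum_range' hdeg,
      Matrix.sum_mulVec]
    refine W.sum_mem fun j hj => ?_
    rw [Matrix.smul_mulVec, ← red_iter]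
    exact W.smul_mem _ (hWcol j (Finset.mem_range.1 hj))
  have hWall : ∀ x, red x ∈ W := by
    intro x
    have hx : x ∈ Submodule.span ℂ⟦X⟧ (Set.range fun ν : ℕ => opA^[ν] f) := hf ▸ trivial
    induction hx using Submodule.span_induction with
    | mem x hx =>
      obtain ⟨ν, rfl⟩ := hx
      exact hW ν
    | zero =>
      have : red 0 = 0 := by
        funext i
        simp [red]
      rw [this]
      exact W.zero_mem
    | add x y _ _ hx hy =>
      rw [red_add]
      exact W.add_mem hx hy
    | smul S x _ hx =>
      rw [red_smul]
      exact W.smul_mem _ hx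
  have hsurj : Function.Surjective B.mulVec := by
    intro v
    have hv : red (∑ i, PowerSeries.C (v i) • e i) = v := by
      funext i
      simp [red, Finsupp.single_apply]
    obtain ⟨w, hw⟩ := hWall (∑ i, PowerSeries.C (v i) • e i)
    exact ⟨w, hw.trans hv⟩
  have hB : IsUnit B.det := (Matrix.isUnit_iff_isUnit_det B).1
    (Matrix.mulVec_surjective_iff_isUnit.1 hsurj)
  have h3 : PowerSeries.coeff 0 P.det = B.det := by
    rw [PowerSeries.coeff_zero_eq_constantCoeff_apply, RingHom.map_det]
  rw [h3]
  exact hB.ne_zero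

/-- The expansion of a vector in terms of vectors whose matrix has an invertible determinant. -/
theorem sum_inv_det_smul {F : Type v} [AddCommGroup F] [Module ℂ⟦X⟧ F] {k : ℕ}
    (e : Module.Basis (Fin k) ℂ⟦X⟧ F) (w : Fin k → F) {P : Matrix (Fin k) (Fin k) ℂ⟦X⟧}
    (hP : ∀ i j, P i j = e.repr (w j) i) (hdet : PowerSeries.coeff 0 P.det ≠ 0) (x : F) :
    x = ∑ j, (P.det⁻¹ * ∑ i, P.adjugate j i * e.repr x i) • w j := by
  apply e.equivFun.injective
  funext i
  have h1 : P.det⁻¹ * P.det = 1 := PowerSeries.inv_mul_cancel _ (by simpa using hdet)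
  have h2 : P.mulVec (P.adjugate.mulVec (e.repr x)) i = P.det * e.repr x i := by
    rw [Matrix.mulVec_mulVec, Matrix.mul_adjugate, Matrix.smul_mulVec, Matrix.one_mulVec]
    rfl
  rw [map_sum, Finset.sum_apply]
  calc e.repr x i = P.det⁻¹ * P.mulVec (P.adjugate.mulVec (e.repr x)) i := by
        rw [h2, ← mul_assoc, h1, one_mul]
    _ = _ := by
        simp only [Matrix.mulVec, dotProduct, map_smul, Pi.smul_apply, smul_eq_mul,
          Module.Basis.equivFun_apply, ← hP]
        rw [Finset.mul_sum]
        exact Finset.sum_congr rfl fun j _ => by ring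

theorem linearIndependent_of_det {F : Type v} [AddCommGroup F] [Module ℂ⟦X⟧ F] {k : ℕ}
    (e : Module.Basis (Fin k) ℂ⟦X⟧ F) (w : Fin k → F) {P : Matrix (Fin k) (Fin k) ℂ⟦X⟧}
    (hP : ∀ i j, P i j = e.repr (w j) i) (hdet : P.det ≠ 0) : LinearIndependent ℂ⟦X⟧ w := by
  rw [Fintype.linearIndependent_iff]
  intro g hg
  have h1 : P.mulVec g = 0 := by
    funext i
    have := congrArg (fun x => e.repr x i) hg
    simpa [Matrix.mulVec, dotProduct, hP, mul_comm] using this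
  exact congrFun (Matrix.eq_zero_of_mulVec_eq_zero hdet h1)

theorem IsGeneratedBy.exists_span_eq_top {E : Type v} [AddCommGroup E] [Module ℂ⟦X⟧ E]
    [ABModule E] {Λ : Finset ℚ} {n : ℕ} {φ : Xi Λ n} (h : IsGeneratedBy E φ) :
    ∃ f : E, Submodule.span ℂ⟦X⟧ (Set.range fun ν : ℕ => opA^[ν] f) = ⊤ := by
  obtain ⟨ι, hι, hιa, hr⟩ := h
  have hφ : φ ∈ LinearMap.range ι := by
    rw [hr]
    exact Submodule.subset_span ⟨0, rfl⟩
  obtain ⟨f, rfl⟩ := hφ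
  refine ⟨f, Submodule.map_injective_of_injective hι ?_⟩
  rw [Submodule.map_top, hr, Submodule.map_span]
  congr 1
  rw [← Set.range_comp]
  congr 1
  funext ν
  exact (Function.Semiconj.iterate_right (f := ι) hιa ν) f

/-! ### Holomorphic maps to `Ξ_Λ`, frames of sheaves, and openness of generation -/

section Frames

variable {X : TopCat.{u}} [ReducedComplexSpace X]

theorem IsHolXi.opA {U : Opens X} {Λ : Finset ℚ} {n : ℕ} {φ : U → Xi Λ n} (hφ : IsHolXi φ) :
    IsHolXi fun x => opA (φ x) := by
  intro l j
  simp only [opA_apply]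
  refine ((hφ l j).bbD.add ((IsHolSeries.const U _).mul (hφ l j))).add ?_
  split_ifs with h
  · exact (IsHolSeries.const U _).mul (hφ l _)
  · exact IsHolSeries.const U 0

theorem IsHolXi.iterate_opA {U : Opens X} {Λ : Finset ℚ} {n : ℕ} {φ : U → Xi Λ n}
    (hφ : IsHolXi φ) (ν : ℕ) : IsHolXi fun x => Themes.opA^[ν] (φ x) := by
  induction ν with
  | zero => exact hφ
  | succ ν ih =>
    simp only [Function.iterate_succ_apply']
    exact ih.opA

theorem IsHolXi.sum_smul {U : Opens X} {Λ : Finset ℚ} {n : ℕ} {ι : Type*} (s : Finset ι)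
    {c : ι → U → ℂ⟦X⟧} {φ : ι → U → Xi Λ n} (hc : ∀ i ∈ s, IsHolSeries (c i))
    (hφ : ∀ i ∈ s, IsHolXi (φ i)) : IsHolXi fun x => ∑ i ∈ s, c i x • φ i x := by
  intro l j
  simp only [Finset.sum_apply, Pi.smul_apply, smul_eq_mul]
  exact IsHolSeries.sum s fun i hi => (hc i hi).mul (hφ i hi l j)

theorem IsHolXi.res {U V : Opens X} (h : V ≤ U) {Λ : Finset ℚ} {n : ℕ} {φ : U → Xi Λ n}
    (hφ : IsHolXi φ) : IsHolXi fun x : V => φ ⟨x, h x.2⟩ := fun l j => (hφ l j).res h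

namespace ABSheaf

variable (𝔽 : ABSheaf.{u, v} X)

/-- The bases `e y` of the fibres form a frame of the sheaf on `U`. -/
def IsFrame {k : ℕ} {U : Opens X} (e : ∀ y : U, Module.Basis (Fin k) ℂ⟦X⟧ (𝔽.fiber y)) : Prop :=
  ∀ (V : Opens X) (hV : V ≤ U) (s : ∀ y : V, 𝔽.fiber y), 𝔽.sec.pred s ↔
    ∃ c : Fin k → V → ℂ⟦X⟧, (∀ i, IsHolSeries (c i)) ∧
      ∀ y : V, s y = ∑ i, c i y • e ⟨y, hV y.2⟩ i

variable {𝔽} {k : ℕ} {U : Opens X} {e : ∀ y : U, Module.Basis (Fin k) ℂ⟦X⟧ (𝔽.fiber y)}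

theorem IsFrame.res (he : 𝔽.IsFrame e) {V : Opens X} (hV : V ≤ U) :
    𝔽.IsFrame fun y : V => e ⟨y, hV y.2⟩ := fun W hW s => he W (hW.trans hV) s

theorem IsFrame.isHolSeries_repr (he : 𝔽.IsFrame e) {V : Opens X} (hV : V ≤ U)
    {s : ∀ y : V, 𝔽.fiber y} (hs : 𝔽.sec.pred s) (i : Fin k) :
    IsHolSeries fun y : V => (e ⟨y, hV y.2⟩).repr (s y) i := by
  obtain ⟨c, hc, hsc⟩ := (he V hV s).1 hs
  have : (fun y : V => (e ⟨y, hV y.2⟩).repr (s y) i) = c i := by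
    funext y
    rw [hsc y]
    simp [Finsupp.single_apply]
  rw [this]
  exact hc i

theorem IsFrame.mem (he : 𝔽.IsFrame e) {V : Opens X} (hV : V ≤ U) (i : Fin k) :
    𝔽.sec.pred fun y : V => e ⟨y, hV y.2⟩ i :=
  (he V hV _).2 ⟨fun j _ => if j = i then 1 else 0, fun _ => IsHolSeries.const V _,
    fun y => by simp⟩

theorem iterate_opA_mem {s : ∀ y : U, 𝔽.fiber y} (hs : 𝔽.sec.pred s) (ν : ℕ) :
    𝔽.sec.pred fun y => opA^[ν] (s y) := by
  induction ν with
  | zero => exact hs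
  | succ ν ih =>
    simp only [Function.iterate_succ_apply']
    exact 𝔽.a_mem ih

/-- A sheaf that has a frame and a holomorphic embedding in `Ξ_l` is a family of themes near
every point whose fibre is generated by one element. -/
theorem IsFrame.exists_isThematic (he : 𝔽.IsFrame e) {l : ℚ}
    (hl : 0 < l ∧ l ≤ 1) (κ : ∀ y : U, 𝔽.fiber y →ₗ[ℂ⟦X⟧] Xi {l} k)
    (hκ : ∀ y, Function.Injective (κ y)) (hκa : ∀ y f, κ y (opA f) = opA (κ y f))
    (hκe : ∀ i, IsHolXi fun y : U => κ y (e y i)) (x₀ : U) (f₀ : 𝔽.fiber x₀)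
    (hf₀ : Submodule.span ℂ⟦X⟧ (Set.range fun ν : ℕ => opA^[ν] f₀) = ⊤) :
    ∃ (U : Opens X) (Λ : Finset ℚ) (φ : U → Xi Λ k)
      (ι : ∀ y : U, 𝔽.fiber y →ₗ[ℂ⟦X⟧] Xi Λ k),
      x₀.1 ∈ U ∧ (∀ l ∈ Λ, 0 < l ∧ l ≤ 1) ∧ IsThematic k φ ∧
      (∀ y : U, Function.Injective (ι y)) ∧
      (∀ (y : U) (e : 𝔽.fiber y), ι y (opA e) = opA (ι y e)) ∧
      ∀ (V : Opens X) (hV : V ≤ U) (t : V → Xi Λ k), IsThematicSection k φ hV t ↔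
        ∃ s : ∀ y : V, 𝔽.fiber y, 𝔽.sec.pred s ∧ ∀ y : V, ι ⟨y, hV y.2⟩ (s y) = t y := by
  let s : ∀ y : U, 𝔽.fiber y := fun y => ∑ i, (e x₀).repr f₀ i • e y i
  have hs : 𝔽.sec.pred s :=
    (he U le_rfl s).2 ⟨fun i _ => (e x₀).repr f₀ i, fun _ => IsHolSeries.const U _, fun _ => rfl⟩
  have hsx : s x₀ = f₀ := (e x₀).sum_repr f₀
  let P : U → Matrix (Fin k) (Fin k) ℂ⟦X⟧ := fun y =>
    Matrix.of fun i j => (e y).repr (opA^[(j : ℕ)] (s y)) i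
  have hPhol : ∀ i j, IsHolSeries fun y => P y i j := fun i j =>
    he.isHolSeries_repr le_rfl (iterate_opA_mem hs j) i
  have hdet : IsHolSeries fun y => (P y).det := IsHolSeries.det hPhol
  -- The points where `s, a s, …, a^{k-1} s` is a basis of the fibre, detected by the constant term
  -- of the determinant.
  let U' : Opens X := ⟨Subtype.val '' {y : U | PowerSeries.coeff 0 (P y).det ≠ 0},
    U.isOpen.isOpenEmbedding_subtypeVal.isOpenMap _
      (isOpen_compl_singleton.preimage (hdet 0).continuous)⟩
  have hU' : U' ≤ U := by
    rintro _ ⟨y, -, rfl⟩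
    exact y.2
  have hP0 : ∀ y : U', PowerSeries.coeff 0 (P ⟨y, hU' y.2⟩).det ≠ 0 := by
    rintro ⟨_, y, hy, rfl⟩
    exact hy
  have hκit : ∀ (y : U) (ν : ℕ) (f : 𝔽.fiber y), κ y (opA^[ν] f) = opA^[ν] (κ y f) :=
    fun y ν f => (Function.Semiconj.iterate_right (f := κ y) (hκa y) ν) f
  let φ : U' → Xi {l} k := fun y => κ ⟨y, hU' y.2⟩ (s ⟨y, hU' y.2⟩)
  -- Cramer's rule expands every section in the `a^j s` with holomorphic coefficients. This gives
  -- both the relations for all `a^ν φ` and one inclusion of sections.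
  have hcoef : ∀ (V : Opens X) (hV : V ≤ U') (r : ∀ y : V, 𝔽.fiber y), 𝔽.sec.pred r →
      ∃ c : Fin k → V → ℂ⟦X⟧, (∀ j, IsHolSeries (c j)) ∧
        ∀ y : V, κ ⟨y, hU' (hV y.2)⟩ (r y) = ∑ j, c j y • opA^[(j : ℕ)] (φ ⟨y, hV y.2⟩) := by
    intro V hV r hr
    have hVU : V ≤ U := hV.trans hU'
    refine ⟨fun j y => (P ⟨y, hVU y.2⟩).det⁻¹ *
      ∑ i, (P ⟨y, hVU y.2⟩).adjugate j i * (e ⟨y, hVU y.2⟩).repr (r y) i, fun j => ?_,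
      fun y => ?_⟩
    · refine ((hdet.res hVU).inv fun y => hP0 ⟨y, hV y.2⟩).mul
        (IsHolSeries.sum _ fun i _ => ?_)
      exact ((IsHolSeries.adjugate hPhol j i).res hVU).mul (he.isHolSeries_repr hVU hr i)
    · have h1 := sum_inv_det_smul (e ⟨y, hVU y.2⟩)
        (fun j : Fin k => opA^[(j : ℕ)] (s ⟨y, hVU y.2⟩)) (P := P ⟨y, hVU y.2⟩)
        (fun _ _ => rfl) (hP0 ⟨y, hV y.2⟩) (r y)
      have h2 := congrArg (κ ⟨y, hVU y.2⟩) h1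
      rw [map_sum] at h2
      simpa only [map_smul, hκit] using h2
  refine ⟨U', {l}, φ, fun y => κ ⟨y, hU' y.2⟩, ⟨x₀, ?_, rfl⟩, ?_, ⟨?_, ?_, ?_⟩,
    fun y => hκ _, fun y f => hκa ⟨y, hU' y.2⟩ f, ?_⟩
  · have := constantCoeff_det_ne_zero (e x₀) f₀ hf₀
    simpa only [Set.mem_ofPred_eq, P, hsx] using this
  · intro l' hl'
    rwa [Finset.mem_singleton.1 hl']
  · have h1 : IsHolXi fun y : U => κ y (s y) := by
      simp only [s, map_sum, map_smul]
      exact IsHolXi.sum_smul _ (fun i _ => IsHolSeries.const U _) fun i _ => hκe i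
    exact h1.res hU'
  · intro y
    have h1 := linearIndependent_of_det (e ⟨y, hU' y.2⟩)
      (fun j : Fin k => opA^[(j : ℕ)] (s ⟨y, hU' y.2⟩)) (P := P ⟨y, hU' y.2⟩)
      (fun _ _ => rfl) (fun h => hP0 y (by rw [h, map_zero]))
    have h2 := h1.map' (κ ⟨y, hU' y.2⟩) (LinearMap.ker_eq_bot.2 (hκ _))
    have h3 : (κ ⟨y, hU' y.2⟩) ∘ (fun j : Fin k => opA^[(j : ℕ)] (s ⟨y, hU' y.2⟩)) =
        fun j : Fin k => opA^[(j : ℕ)] (φ y) := funext fun j => hκit _ _ _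
    rwa [h3] at h2
  · intro ν
    obtain ⟨c, hc, hcs⟩ := hcoef U' le_rfl (fun y => opA^[ν] (s ⟨y, hU' y.2⟩))
      (𝔽.sec.res hU'.hom _ (iterate_opA_mem hs ν))
    exact ⟨c, hc, fun y => by rw [← hcs y, hκit]⟩
  · intro V hV t
    constructor
    · rintro ⟨c, hc, ht⟩
      have hVU : V ≤ U := hV.trans hU'
      refine ⟨fun y => ∑ j, c j y • opA^[(j : ℕ)] (s ⟨y, hVU y.2⟩), ?_, fun y => ?_⟩
      · refine (he V hVU _).2 ⟨fun i y => ∑ j, c j y * P ⟨y, hVU y.2⟩ i j, fun i =>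
          IsHolSeries.sum _ fun j _ => (hc j).mul ((hPhol i j).res hVU), fun y => ?_⟩
        have h1 : ∀ j : Fin k, opA^[(j : ℕ)] (s ⟨y, hVU y.2⟩) =
            ∑ i, P ⟨y, hVU y.2⟩ i j • e ⟨y, hVU y.2⟩ i := fun j =>
          ((e ⟨y, hVU y.2⟩).sum_repr _).symm
        simp only [h1, Finset.smul_sum, smul_smul, Finset.sum_smul]
        exact Finset.sum_comm
      · rw [ht y, map_sum]
        simp only [map_smul, hκit]
        rfl
    · rintro ⟨r, hr, hrt⟩
      obtain ⟨c, hc, hcr⟩ := hcoef V hV r hr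
      exact ⟨c, hc, fun y => by rw [← hrt y, hcr y]⟩

end ABSheaf

end Frames

/-! ### Fundamental matrices of a family -/

section Duality

variable {X : TopCat.{u}} [ReducedComplexSpace X]

namespace ABSheaf

variable {𝔼 : ABSheaf.{u, v} X} {k : ℕ}

/-- The basis of `E(y)* ⊗ E_δ` dual to a basis of `E(y)`. -/
def twistedDualBasis {E : Type v} [AddCommGroup E] [Module ℂ⟦X⟧ E] (δ : ℚ)
    (e : Module.Basis (Fin k) ℂ⟦X⟧ E) :
    Module.Basis (Fin k) ℂ⟦X⟧ (ABDual E ⊗[ℂ⟦X⟧] RankOne δ) :=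
  (dualB e).map (untwist δ _).symm

theorem twistedDualBasis_repr {E : Type v} [AddCommGroup E] [Module ℂ⟦X⟧ E] {δ : ℚ}
    (e : Module.Basis (Fin k) ℂ⟦X⟧ E) (t : ABDual E ⊗[ℂ⟦X⟧] RankOne δ) (i : Fin k) :
    (twistedDualBasis δ e).repr t i = (untwist δ _ t (e i)).series := by
  let σ : Module.Dual ℂ⟦X⟧ E := untwist δ (ABDual E) t
  exact e.dualBasis_repr σ i

theorem series_apply_eq_sum {E : Type v} [AddCommGroup E] [Module ℂ⟦X⟧ E]
    (e : Module.Basis (Fin k) ℂ⟦X⟧ E) (σ : ABDual E) (x : E) :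
    (σ x).series = ∑ i, e.repr x i * (σ (e i)).series := by
  conv_lhs => rw [← e.sum_repr x]
  rw [map_sum]
  simp only [map_smul]
  exact map_sum (AddMonoidHom.mk' (fun y : RankOne 0 => y.series) fun _ _ => rfl)
    (fun i => e.repr x i • σ (e i)) Finset.univ

/-- Evaluating on `e i` gives `a (σ (e i)) - σ (a (e i))`, where `a` acts on `E_0` as `b² d/db`; the
twist adds `δ b`. This reduces the study of the twisted dual to matrices. -/
theorem twistedDualBasis_opA {E : Type v} [AddCommGroup E] [Module ℂ⟦X⟧ E] [ABModule E] (δ : ℚ)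
    (e : Module.Basis (Fin k) ℂ⟦X⟧ E) (t : ABDual E ⊗[ℂ⟦X⟧] RankOne δ) :
    (twistedDualBasis δ e).equivFun (opA t) =
      dualAct (Matrix.of fun i j => e.repr (opA (e i)) j) δ ((twistedDualBasis δ e).equivFun t) := by
  funext i
  simp only [Module.Basis.equivFun_apply, dualAct, twistedDualBasis_repr, untwist_a]
  set σ : ABDual E := untwist δ (ABDual E) t
  have h1 : ((opA σ + (PowerSeries.C (δ : ℂ) * PowerSeries.X) • σ) (e i)).series =
      rankOneA 0 (σ (e i)).series - (σ (opA (e i))).series +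
        PowerSeries.C (δ : ℂ) * PowerSeries.X * (σ (e i)).series := rfl
  rw [h1, series_apply_eq_sum e σ (opA (e i)), rankOneA]
  simp [Matrix.mulVec, dotProduct, twistedDualBasis_repr, σ]

theorem repr_sum_smul {E : Type v} [AddCommGroup E] [Module ℂ⟦X⟧ E]
    (e : Module.Basis (Fin k) ℂ⟦X⟧ E) (c : Fin k → ℂ⟦X⟧) (i : Fin k) :
    e.repr (∑ j, c j • e j) i = c i := by
  simp [Finsupp.single_apply]

theorem equivFun_self_eq_single {E : Type v} [AddCommGroup E] [Module ℂ⟦X⟧ E]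
    (e : Module.Basis (Fin k) ℂ⟦X⟧ E) (i : Fin k) : e.equivFun (e i) = Pi.single i 1 := by
  funext j
  simp [Pi.single_apply, eq_comm]

theorem dualEmbedding_single (l' : ℚ) (H : Matrix (Fin k) (Fin k) ℂ⟦X⟧) (i : Fin k)
    (ν : ({l'} : Finset ℚ)) (j : Fin k) :
    dualEmbedding l' H (Pi.single i 1) ν j = (-1) ^ (j : ℕ) * H j.rev i := by
  rw [dualEmbedding_apply, Matrix.mulVec_single_one]
  rfl

/-- The coordinates of a form in the dual basis are its values on the frame, so they are holomorphic
exactly when the form sends sections to holomorphic series. -/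
theorem IsFrame.dual_twist {U : Opens X} {e : ∀ y : U, Module.Basis (Fin k) ℂ⟦X⟧ (𝔼.fiber y)}
    (he : 𝔼.IsFrame e) (δ : ℚ) :
    (𝔼.dual.twist δ).IsFrame fun y : U => twistedDualBasis δ (e y) := by
  intro V hV s
  have hrepr : ∀ y : V, ∀ i, (twistedDualBasis δ (e ⟨y, hV y.2⟩)).repr (s y) i =
      (untwist δ (ABDual (𝔼.fiber y)) (s y) (e ⟨y, hV y.2⟩ i)).series :=
    fun y i => twistedDualBasis_repr _ _ i
  constructor
  · intro h
    refine ⟨fun i y => (twistedDualBasis δ (e ⟨y, hV y.2⟩)).repr (s y) i, fun i => ?_,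
      fun y => ((twistedDualBasis δ (e ⟨y, hV y.2⟩)).sum_repr (s y)).symm⟩
    simp only [hrepr]
    exact h V le_rfl _ (he.mem hV i)
  · rintro ⟨c, hc, hs⟩ W hW r hr
    have hc' : ∀ y i, c i y =
        (untwist δ (ABDual (𝔼.fiber y)) (s y) (e ⟨y, hV y.2⟩ i)).series := fun y i => by
      rw [← hrepr, hs y]
      exact (repr_sum_smul (twistedDualBasis δ (e ⟨y, hV y.2⟩)) (fun i => c i y) i).symm
    have h1 : (fun y : W =>
        (untwist δ (ABDual (𝔼.fiber y)) (s ⟨y, hW y.2⟩) (r y)).series) = fun y : W =>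
        ∑ i, (e ⟨y, hV (hW y.2)⟩).repr (r y) i * c i ⟨y, hW y.2⟩ := by
      funext y
      simp only [hc']
      exact series_apply_eq_sum (e ⟨y, hV (hW y.2)⟩) _ _
    change IsHolSeries fun y : W => (untwist δ (ABDual (𝔼.fiber y)) (s ⟨y, hW y.2⟩) (r y)).series
    rw [h1]
    exact IsHolSeries.sum _ fun i _ => (he.isHolSeries_repr (hW.trans hV) hr i).mul
      ((hc i).res hW)

/-- A family of `[l]`-primitive themes has locally a frame `e` and a holomorphic fundamental
matrix, the matrix of an embedding in `Ξ_l`. -/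
theorem IsHolomorphicFamily.exists_fundamental (h𝔼 : 𝔼.IsHolomorphicFamily k) {l : ℚ}
    (hl : 0 < l ∧ l ≤ 1) (hprim : ∀ x : X, IsPrimitiveTheme l (𝔼.fiber x)) (x : X) :
    ∃ (U : Opens X) (e : ∀ y : U, Module.Basis (Fin k) ℂ⟦X⟧ (𝔼.fiber y))
      (M : U → Matrix (Fin k) (Fin k) ℂ⟦X⟧), x ∈ U ∧ 𝔼.IsFrame e ∧
      (∀ i j, IsHolSeries fun y => M y i j) ∧
      ∀ y, (M y).det ≠ 0 ∧ (M y).map bbD + M y * jordanA l k =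
        (Matrix.of fun i j => (e y).repr (opA (e y i)) j) * M y := by
  obtain ⟨U₁, Λ, φ, ι, hx₁, hΛ, ⟨hφ, hφind, -⟩, hι, hιa, hsec⟩ := h𝔼 x
  obtain ⟨U₂, k', e, hx₂, he : 𝔼.IsFrame e⟩ := 𝔼.locally_free x
  let U := U₁ ⊓ U₂
  have hU₁ : U ≤ U₁ := inf_le_left
  have hU₂ : U ≤ U₂ := inf_le_right
  have hxU : x ∈ U := ⟨hx₁, hx₂⟩
  have hthem : ∀ i, IsThematicSection k φ hU₁
      fun y : U => ι ⟨y, hU₁ y.2⟩ (e ⟨y, hU₂ y.2⟩ i) := fun i =>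
    (hsec U hU₁ _).2 ⟨_, he.mem hU₂ i, fun _ => rfl⟩
  -- Local freeness gives a frame of some size `k'`; comparing ranks in the fibre at `x` shows that
  -- `k' = k`.
  have hrange : LinearMap.range (ι ⟨x, hx₁⟩) = Submodule.span ℂ⟦X⟧
      (Set.range fun j : Fin k => opA^[(j : ℕ)] (φ ⟨x, hx₁⟩)) := by
    apply le_antisymm
    · rintro _ ⟨v, rfl⟩
      rw [← (e ⟨x, hx₂⟩).sum_repr v, map_sum]
      refine Submodule.sum_mem _ fun i _ => ?_
      rw [map_smul]
      refine Submodule.smul_mem _ _ ?_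
      obtain ⟨c, -, hc⟩ := hthem i
      have h1 := hc ⟨x, hxU⟩
      simp only at h1
      rw [h1]
      exact Submodule.sum_mem _ fun j _ =>
        Submodule.smul_mem _ _ (Submodule.subset_span ⟨j, rfl⟩)
    · rw [Submodule.span_le]
      rintro _ ⟨j, rfl⟩
      obtain ⟨s, -, hs⟩ := (hsec U hU₁ fun y => opA^[(j : ℕ)] (φ ⟨y, hU₁ y.2⟩)).1
        ⟨fun i _ => if i = j then 1 else 0, fun _ => IsHolSeries.const U _, fun y => by simp⟩
      exact ⟨s ⟨x, hxU⟩, hs ⟨x, hxU⟩⟩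
  have hk : k' = k := by
    have h1 := (LinearEquiv.ofInjective _ (hι ⟨x, hx₁⟩)).finrank_eq
    rw [hrange, finrank_span_eq_card (hφind ⟨x, hx₁⟩),
      Module.finrank_eq_card_basis (e ⟨x, hx₂⟩)] at h1
    simpa using h1
  subst hk
  -- In rank zero `l` need not belong to `Λ`, and the empty matrix serves.
  rcases Nat.eq_zero_or_pos k' with h0 | hpos
  · subst h0
    exact ⟨U, fun y => e ⟨y, hU₂ y.2⟩, fun _ => 1, hxU, he.res hU₂, fun i => i.elim0,
      fun y => ⟨by simp, Subsingleton.elim _ _⟩⟩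
  have hzero : ∀ (y : U) (v : 𝔼.fiber y) (μ : Λ), (μ : ℚ) ≠ l → ι ⟨y, hU₁ y.2⟩ v μ = 0 := by
    intro y v μ hμ
    obtain ⟨n, ψ, θ, hθ, hθa, -⟩ := hprim y
    exact apply_eq_zero_of_primitive hl hΛ θ hθ hθa (ι ⟨y, hU₁ y.2⟩) (hιa ⟨y, hU₁ y.2⟩) v μ hμ
  have hlΛ : l ∈ Λ := by
    by_contra hnot
    have h1 : e ⟨x, hx₂⟩ ⟨0, hpos⟩ = 0 := hι ⟨x, hx₁⟩ (by
      rw [map_zero]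
      funext μ
      exact hzero ⟨x, hxU⟩ _ μ fun h => hnot (h ▸ μ.2))
    exact (e ⟨x, hx₂⟩).ne_zero _ h1
  let l₀ : Λ := ⟨l, hlΛ⟩
  refine ⟨U, fun y => e ⟨y, hU₂ y.2⟩,
    fun y => Matrix.of fun i j => ι ⟨y, hU₁ y.2⟩ (e ⟨y, hU₂ y.2⟩ i) l₀ j, hxU, he.res hU₂,
    fun i j => ?_, fun y => ⟨fun hdet => ?_, ?_⟩⟩
  · obtain ⟨c, hc, hct⟩ := hthem i
    have h1 : IsHolXi fun y : U => ι ⟨y, hU₁ y.2⟩ (e ⟨y, hU₂ y.2⟩ i) := by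
      simp only [hct]
      exact IsHolXi.sum_smul _ (fun j _ => hc j) fun j _ => (hφ.iterate_opA j).res hU₁
    exact h1 l₀ j
  -- A relation between the rows of `M` kills the component at `l` of the image of `∑ v i • e i`.
  -- The other components vanish by primitivity, so injectivity applies.
  · obtain ⟨v, hv, hv0⟩ := Matrix.exists_vecMul_eq_zero_iff.2 hdet
    have h1 : ∑ i, v i • e ⟨y, hU₂ y.2⟩ i = 0 := hι ⟨y, hU₁ y.2⟩ (by
      rw [map_zero]
      funext μ
      by_cases hμ : (μ : ℚ) = l
      · have : μ = l₀ := Subtype.ext hμ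
        subst this
        funext j
        have h2 := congrFun hv0 j
        simpa [Matrix.vecMul, dotProduct] using h2
      · exact hzero y _ μ hμ)
    exact hv (funext (Fintype.linearIndependent_iff.1 (e ⟨y, hU₂ y.2⟩).linearIndependent v h1))
  · ext1 i j
    have h1 := congrFun (congrFun (hιa ⟨y, hU₁ y.2⟩ (e ⟨y, hU₂ y.2⟩ i)) l₀) j
    have h2 : ι ⟨y, hU₁ y.2⟩ (opA (e ⟨y, hU₂ y.2⟩ i)) =
        ∑ p, (e ⟨y, hU₂ y.2⟩).repr (opA (e ⟨y, hU₂ y.2⟩ i)) p •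
          ι ⟨y, hU₁ y.2⟩ (e ⟨y, hU₂ y.2⟩ p) := by
      conv_lhs => rw [← (e ⟨y, hU₂ y.2⟩).sum_repr (opA (e ⟨y, hU₂ y.2⟩ i))]
      rw [map_sum]
      simp only [map_smul]
    rw [h2, opA_apply] at h1
    rw [Matrix.add_apply, Matrix.map_apply, Matrix.mul_apply, sum_mul_jordanA, Matrix.mul_apply,
      ← add_assoc]
    simpa using h1.symm

/-- The order of the determinant of a holomorphic fundamental matrix is locally constant. -/
theorem exists_order_det_const {U : Opens X} {l : ℚ} {M C : U → Matrix (Fin k) (Fin k) ℂ⟦X⟧}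
    (hC : ∀ i j, IsHolSeries fun y => C y i j)
    (hM : ∀ y, (M y).det ≠ 0 ∧ (M y).map bbD + M y * jordanA l k = C y * M y) (x : U) :
    ∃ (V : Opens X) (hV : V ≤ U) (m : ℕ), x.1 ∈ V ∧ ∀ y : V,
      (∀ n < m, PowerSeries.coeff n (M ⟨y, hV y.2⟩).det = 0) ∧
        PowerSeries.coeff m (M ⟨y, hV y.2⟩).det ≠ 0 := by
  classical
  have hex : ∀ y, ∃ n, PowerSeries.coeff n (M y).det ≠ 0 := fun y =>
    PowerSeries.exists_coeff_ne_zero_iff_ne_zero.2 (hM y).1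
  let o : U → ℕ := fun y => Nat.find (hex y)
  have hlow : ∀ y, ∀ n < o y, PowerSeries.coeff n (M y).det = 0 := fun y n hn => by
    simpa using Nat.find_min (hex y) hn
  let τ : U → ℂ := fun y => PowerSeries.coeff 1
    ((C y).trace - PowerSeries.C ((k * l : ℚ) : ℂ) * PowerSeries.X)
  have hτ : ∀ y, τ y = o y := fun y =>
    coeff_one_eq_order (bbD_det_of_fundamental (hM y).2) (hlow y) (Nat.find_spec (hex y))
  have hτc : Continuous τ := by
    have h1 : IsHolSeries fun y => (C y).trace -
        PowerSeries.C ((k * l : ℚ) : ℂ) * PowerSeries.X :=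
      (IsHolSeries.sum _ fun i _ => hC i i).sub (IsHolSeries.const U _)
    exact (h1 1).continuous
  -- Radius `1` suffices, because `τ` takes integer values.
  let V : Opens X := ⟨Subtype.val '' (τ ⁻¹' Metric.ball (τ x) 1),
    U.isOpen.isOpenEmbedding_subtypeVal.isOpenMap _ (Metric.isOpen_ball.preimage hτc)⟩
  have hV : V ≤ U := by
    rintro _ ⟨y, -, rfl⟩
    exact y.2
  have ho : ∀ y : V, o ⟨y, hV y.2⟩ = o x := by
    rintro ⟨_, y, hy, rfl⟩
    have h1 : dist (τ y) (τ x) < 1 := hy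
    rw [hτ, hτ, dist_eq_norm] at h1
    have h2 : ‖((o y - o x : ℤ) : ℂ)‖ < 1 := by
      push_cast
      exact h1
    rw [Complex.norm_intCast] at h2
    have h3 : |(o y - o x : ℤ)| < 1 := by exact_mod_cast h2
    rw [Int.abs_lt_one_iff] at h3
    change o y = o x
    omega
  refine ⟨V, hV, o x, ⟨x, Metric.mem_ball_self one_pos, rfl⟩, fun y => ?_⟩
  rw [← ho y]
  exact ⟨hlow _, Nat.find_spec (hex ⟨y, hV y.2⟩)⟩

/-- If the modules `E(x)* ⊗ E_δ` are themes, then the family has locally a holomorphic embedding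
in some `Ξ_{l'}`. -/
theorem IsHolomorphicFamily.exists_dual_embedding (h𝔼 : 𝔼.IsHolomorphicFamily k) {l : ℚ}
    (hl : 0 < l ∧ l ≤ 1) (hprim : ∀ x : X, IsPrimitiveTheme l (𝔼.fiber x)) (δ : ℚ)
    (hδ : ∀ x : X, IsTheme (ABDual (𝔼.fiber x) ⊗[ℂ⟦X⟧] RankOne δ)) (x : X) :
    ∃ (U : Opens X) (e : ∀ y : U, Module.Basis (Fin k) ℂ⟦X⟧ (𝔼.fiber y)) (l' : ℚ)
      (κ : ∀ y : U, (𝔼.dual.twist δ).fiber y →ₗ[ℂ⟦X⟧] Xi {l'} k),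
      x ∈ U ∧ 𝔼.IsFrame e ∧ (0 < l' ∧ l' ≤ 1) ∧ (∀ y, Function.Injective (κ y)) ∧
      (∀ y f, κ y (opA f) = opA (κ y f)) ∧
      ∀ i, IsHolXi fun y : U => κ y (twistedDualBasis δ (e y) i) := by
  obtain ⟨U, e, M, hxU, he, hMhol, hM⟩ := h𝔼.exists_fundamental hl hprim x
  rcases Nat.eq_zero_or_pos k with h0 | hpos
  · subst h0
    have hsub : ∀ y : U, Subsingleton ((𝔼.dual.twist δ).fiber y) := fun y =>
      (twistedDualBasis δ (e y)).equivFun.injective.subsingleton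
    exact ⟨U, e, 1, fun _ => 0, hxU, he, by norm_num, fun y a b _ => (hsub y).elim a b,
      fun y f => by simp, fun i => i.elim0⟩
  have : NeZero k := ⟨hpos.ne'⟩
  have hH : ∀ y : U, ∃ (q : ℕ) (l' : ℚ), (0 < l' ∧ l' ≤ 1) ∧ δ - l = q + l' ∧
      ∃ H : Matrix (Fin k) (Fin k) ℂ⟦X⟧, M y * H = (PowerSeries.X ^ q : ℂ⟦X⟧) • 1 := by
    intro y
    obtain ⟨Λ, n, φ, hΛ, θ, hθ, hθa, -⟩ := hδ y
    let E := (twistedDualBasis δ (e y)).equivFun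
    refine exists_mul_eq_X_pow (hM y).2 (hM y).1 hΛ (θ ∘ₗ E.symm.toLinearMap)
      (hθ.comp E.symm.injective) fun f => ?_
    have h1 := twistedDualBasis_opA δ (e y) (E.symm f)
    rw [LinearEquiv.apply_symm_apply] at h1
    rw [← h1]
    simp only [LinearMap.comp_apply, LinearEquiv.coe_coe]
    rw [← hθa]
    exact congrArg θ (E.symm_apply_apply _)
  -- The decomposition `δ - l = q + l'` is unique, so the values found at `x` serve at every `y`.
  obtain ⟨q, l', hl', hq, -⟩ := hH ⟨x, hxU⟩
  have hH' : ∀ y : U, ∃ H : Matrix (Fin k) (Fin k) ℂ⟦X⟧,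
      M y * H = (PowerSeries.X ^ q : ℂ⟦X⟧) • 1 := by
    intro y
    obtain ⟨q₁, l₁, hl₁, hq₁, H, hH⟩ := hH y
    rw [(natCast_add_inj hl' hl₁ (hq.symm.trans hq₁)).1]
    exact ⟨H, hH⟩
  choose H hH using hH'
  obtain ⟨V, hV, m, hxV, hm⟩ := exists_order_det_const
    (fun i j => he.isHolSeries_repr le_rfl (𝔼.a_mem (he.mem le_rfl i)) j) hM ⟨x, hxU⟩
  -- `H` was chosen point by point, but `det M • H = b^q • adj M` determines it, and the order of
  -- `det M` is constant on `V`.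
  have hHhol : ∀ i j, IsHolSeries fun y : V => H ⟨y, hV y.2⟩ i j := by
    intro i j
    refine IsHolSeries.of_mul m ((IsHolSeries.det hMhol).res hV)
      ((IsHolSeries.const V (PowerSeries.X ^ q)).mul ((IsHolSeries.adjugate hMhol i j).res hV))
      (fun y => (hm y).1) (fun y => (hm y).2) fun y => ?_
    have h1 : (M ⟨y, hV y.2⟩).det • H ⟨y, hV y.2⟩ =
        (PowerSeries.X ^ q : ℂ⟦X⟧) • (M ⟨y, hV y.2⟩).adjugate := by
      rw [← one_mul (H _), ← Matrix.smul_mul, ← Matrix.adjugate_mul, mul_assoc, hH,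
        Matrix.mul_smul, mul_one]
    exact congrFun (congrFun h1 i) j
  refine ⟨V, fun y => e ⟨y, hV y.2⟩, l', fun y => dualEmbedding l' (H ⟨y, hV y.2⟩) ∘ₗ
    (twistedDualBasis δ (e ⟨y, hV y.2⟩)).equivFun.toLinearMap, hxV, he.res hV, hl',
    fun y => (dualEmbedding_injective (hH ⟨y, hV y.2⟩)).comp (LinearEquiv.injective _),
    fun y f => ?_, fun i ν j => ?_⟩
  · have h1 := dualEmbedding_dualAct (hM ⟨y, hV y.2⟩).2 (hH ⟨y, hV y.2⟩) hq
      ((twistedDualBasis δ (e ⟨y, hV y.2⟩)).equivFun f)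
    exact (congrArg (dualEmbedding l' (H ⟨y, hV y.2⟩))
      (twistedDualBasis_opA δ (e ⟨y, hV y.2⟩) f)).trans h1
  · have h1 : ∀ y : V, (dualEmbedding l' (H ⟨y, hV y.2⟩) ∘ₗ
        (twistedDualBasis δ (e ⟨y, hV y.2⟩)).equivFun.toLinearMap)
        (twistedDualBasis δ (e ⟨y, hV y.2⟩) i) ν j =
        (-1) ^ (j : ℕ) * H ⟨y, hV y.2⟩ j.rev i := by
      intro y
      rw [← dualEmbedding_single l' (H ⟨y, hV y.2⟩) i ν j]
      exact congrArg (fun g => dualEmbedding l' (H ⟨y, hV y.2⟩) g ν j)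
        (equivFun_self_eq_single (twistedDualBasis δ (e ⟨y, hV y.2⟩)) i)
    have h2 : IsHolSeries fun y : V => (-1 : ℂ⟦X⟧) ^ (j : ℕ) * H ⟨y, hV y.2⟩ j.rev i :=
      (IsHolSeries.const V _).mul (hHhol _ _)
    exact (funext h1 : _ = _) ▸ h2

end ABSheaf

end Duality

end Themes

end

/-! ### The duality theorem -/

open Themes
open scoped TensorProduct
theorem theorem1p5p1 {X : TopCat.{u}} [ReducedComplexSpace X] (k : ℕ)
    (l : ℚ) (hl : 0 < l ∧ l ≤ 1)
    (𝔼 : ABSheaf.{u, v} X) (h𝔼 : 𝔼.IsHolomorphicFamily k)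
    (hprim : ∀ x : X, IsPrimitiveTheme l (𝔼.fiber x))
    (δ : ℚ) (hδ : ∀ x : X, IsTheme (ABDual (𝔼.fiber x) ⊗[PowerSeries ℂ] RankOne δ)) :
    (𝔼.dual.twist δ).IsHolomorphicFamily k := by
  intro x
  obtain ⟨U, e, l', κ, hx, he, hl', hκ, hκa, hκe⟩ :=
    h𝔼.exists_dual_embedding hl hprim δ hδ x
  -- Here the theme structure at `x` supplies a generator of the fibre; the embedding near `x` is
  -- the holomorphic `κ`.
  obtain ⟨Λ, n, φ, -, hφ⟩ := hδ x
  obtain ⟨f₀, hf₀⟩ := hφ.exists_span_eq_top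
  exact (he.dual_twist δ).exists_isThematic hl' κ hκ hκa hκe ⟨x, hx⟩ f₀ hf₀
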